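/- Notation. Let $n\ge 1$; functions on $\mathbb R^n$ are real- or complex-valued (or $[0,\infty]$-valued, in the case of $M_b^lf$). For $\vec q=(q_1,\dots,q_n)\in(0,\infty)^n$ let $L^{\vec q}(\mathbb R^n)$ be the space of measurable $f$ with $$\|f\|_{L^{\vec q}}=\Bigl(\int_{\mathbb R}\cdots\Bigl(\int_{\mathbb R}\Bigl(\int_{\mathbb R}|f(x_1,\dots,x_n)|^{q_1}dx_1\Bigr)^{q_2/q_1}dx_2\Bigr)^{q_3/q_2}\cdots dx_n\Bigr)^{1/q_n}<\infty ,$$ and let $f\in L^{\vec q}_{\rm loc}(\mathbb R^n)$ mean that $f$ is measurable and $f\chi_K\in L^{\vec q}(\mathbb R^n)$ for every compact $K\subset\mathbb R^n$. Put $B_k=\{x\in\mathbb R^n:|x|\le 2^k\}$ and $\chi_k=\chi_{B_k\setminus B_{k-1}}$ for $k\in\mathbb Z$. For $\alpha\in\mathbb R$, $\lambda\ge 0$, $0<p\le\infty$ and $\vec q\in[1,\infty)^n$, the homogeneous mixed Herz-Morrey space $M\dot K^{\alpha,\lambda}_{p,\vec q}(\mathbb R^n)$ consists of all $f\in L^{\vec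 q}_{\rm loc}(\mathbb R^n)$ with $$\|f\|_{M\dot K^{\alpha,\lambda}_{p,\vec q}}=\sup_{k_0\in\mathbb Z}2^{-k_0\lambda}\Bigl(\sum_{k=-\infty}^{k_0}2^{k\alpha p}\|f\chi_k\|_{L^{\vec q}}^p\Bigr)^{1/p}<\infty ,$$ where for $p=\infty$ the expression $(\sum\cdots)^{1/p}$ is replaced by $\sup_{k\le k_0}2^{k\alpha}\|f\chi_k\|_{L^{\vec q}}$. A locally integrable function $b$ belongs to $BMO(\mathbb R^n)$ if its mean oscillations $\frac1{|B|}\int_B|b-b_B|$, with $b_B=\frac1{|B|}\int_B b$, are bounded uniformly over all balls $B$. For $1<l<\infty$, $\frac1l+\frac1{l'}=1$, the fractional maximal commutator is $$M_b^lf(x)=\sup_{r>0}|B(x,r)|^{-1/l'}\int_{B(x,r)}|b(x)-b(y)|\,|f(y)|\,dy,\qquad B(x,r)=\{y:|x-y|\le r\}.$$ An operator $T$ is bounded from $X$ to $Y$ if there is a finite constant $C$ such that $Tf\in Y$ and $\|Tf\|_Y\le C\|f\|_X$ for all $f\in X$. Theorem. Let $b\in BMO(\mathbb R^n)$, $1<l<\infty$,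 $0\le\lambda<\infty$, $0<p_1\le p_2\le\infty$, $\vec q_1=(q_{11},\dots,q_{1n})$ with $1<q_{1i}<l$ for all $i$, $\vec q_2=(q_{21},\dots,q_{2n})\in[1,\infty)^n$, $$\frac1l=\frac1n\sum_{i=1}^n\frac1{q_{1i}}-\frac1n\sum_{i=1}^n\frac1{q_{2i}}\qquad\text{and}\qquad \lambda-\sum_{i=1}^n\frac1{q_{2i}}<\alpha<n-\sum_{i=1}^n\frac1{q_{1i}} .$$ Suppose that $M_b^l$ is bounded from $L^{\vec q_1}(\mathbb R^n)$ to $L^{\vec q_2}(\mathbb R^n)$. Then $M_b^l$ is also bounded from $M\dot K^{\alpha,\lambda}_{p_1,\vec q_1}(\mathbb R^n)$ to $M\dot K^{\alpha,\lambda}_{p_2,\vec q_2}(\mathbb R^n)$. -/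

import Mathlib

open MeasureTheory Set
open scoped ENNReal NNReal

noncomputable section

namespace MixedHerzMorrey

/-- The iterated norm
`(∫ … (∫ (∫ g(x₁,…,xₙ)^{q₁} dx₁)^{q₂/q₁} dx₂)^{q₃/q₂} … dxₙ)^{1/qₙ}`
of a nonnegative function of `n` real variables: take the `L^{q₁}` norm in the first variable,
then proceed with the remaining `n - 1` variables. -/
def iterNorm : (n : ℕ) → (Fin n → ℝ) → ((Fin n → ℝ) → ℝ≥0∞) → ℝ≥0∞
  | 0, _, g => g Fin.elim0
  | n + 1, q, g =>
      iterNorm n (Fin.tail q) fun y => (∫⁻ t : ℝ, g (Fin.cons t y) ^ q 0) ^ (1 / q 0)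

/-- The mixed Lebesgue (quasi-)norm `‖g‖_{L^q⃗(ℝⁿ)}` of a `[0,∞]`-valued function on `ℝⁿ`. -/
def mixedNorm {n : ℕ} (q : Fin n → ℝ) (g : EuclideanSpace ℝ (Fin n) → ℝ≥0∞) : ℝ≥0∞ :=
  iterNorm n q fun x => g (WithLp.toLp 2 x)

/-- `f ∈ L^q⃗(ℝⁿ)`; the values of `f` may be real, complex, or in `[0,∞]`. -/
def MemMixedLp {n : ℕ} {F : Type*} [TopologicalSpace F] [ENorm F] (q : Fin n → ℝ)
    (f : EuclideanSpace ℝ (Fin n) → F) : Prop :=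
  AEStronglyMeasurable f volume ∧ mixedNorm q (fun x => ‖f x‖ₑ) < ∞

/-- `f ∈ L^q⃗_loc(ℝⁿ)`: the function `f` is measurable and `f χ_K ∈ L^q⃗(ℝⁿ)` for every
compact `K`. -/
def MemMixedLpLoc {n : ℕ} {F : Type*} [TopologicalSpace F] [ENorm F] (q : Fin n → ℝ)
    (f : EuclideanSpace ℝ (Fin n) → F) : Prop :=
  AEStronglyMeasurable f volume ∧
    ∀ K : Set (EuclideanSpace ℝ (Fin n)), IsCompact K →
      mixedNorm q (K.indicator fun x => ‖f x‖ₑ) < ∞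

/-- The dyadic annulus `A_k = B_k \ B_{k-1}`, where `B_k = {x : |x| ≤ 2^k}`. -/
def annulus (n : ℕ) (k : ℤ) : Set (EuclideanSpace ℝ (Fin n)) :=
  Metric.closedBall 0 ((2 : ℝ) ^ k) \ Metric.closedBall 0 ((2 : ℝ) ^ (k - 1))

/-- The homogeneous mixed Herz-Morrey (quasi-)norm of a `[0,∞]`-valued function `g`,
`sup_{k₀ ∈ ℤ} 2^{-k₀ λ} (∑_{k ≤ k₀} 2^{k α p} ‖g χ_k‖_{L^q⃗}^p)^{1/p}`,
with the sum replaced by `sup_{k ≤ k₀} 2^{k α} ‖g χ_k‖_{L^q⃗}` when `p = ∞`. -/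
def herzMorreyNorm {n : ℕ} (α lam : ℝ) (p : ℝ≥0∞) (q : Fin n → ℝ)
    (g : EuclideanSpace ℝ (Fin n) → ℝ≥0∞) : ℝ≥0∞ :=
  ⨆ k₀ : ℤ, (2 : ℝ≥0∞) ^ (-((k₀ : ℝ) * lam)) *
    if p = ∞ then
      ⨆ k : Iic k₀,
        (2 : ℝ≥0∞) ^ (((k : ℤ) : ℝ) * α) * mixedNorm q ((annulus n k).indicator g)
    else
      (∑' k : Iic k₀, (2 : ℝ≥0∞) ^ (((k : ℤ) : ℝ) * α * p.toReal) *
        mixedNorm q ((annulus n k).indicator g) ^ p.toReal) ^ (1 / p.toReal)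

/-- Membership in the homogeneous mixed Herz-Morrey space: `f ∈ L^q⃗_loc(ℝⁿ)` and the
Herz-Morrey norm of `f` is finite. -/
def MemHerzMorrey {n : ℕ} {F : Type*} [TopologicalSpace F] [ENorm F] (α lam : ℝ) (p : ℝ≥0∞)
    (q : Fin n → ℝ) (f : EuclideanSpace ℝ (Fin n) → F) : Prop :=
  MemMixedLpLoc q f ∧ herzMorreyNorm α lam p q (fun x => ‖f x‖ₑ) < ∞

/-- `b ∈ BMO(ℝⁿ)`: `b` is locally integrable and its mean oscillations over all balls are
uniformly bounded. -/
def MemBMO {n : ℕ} {𝕜 : Type*} [RCLike 𝕜] (b : EuclideanSpace ℝ (Fin n) → 𝕜) : Prop :=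
  LocallyIntegrable b volume ∧
    ∃ C : ℝ, ∀ (x : EuclideanSpace ℝ (Fin n)) (r : ℝ), 0 < r →
      ⨍ y in Metric.closedBall x r, ‖b y - ⨍ z in Metric.closedBall x r, b z‖ ≤ C

/-- The fractional maximal commutator
`M_b^l f(x) = sup_{r > 0} |B(x,r)|^{-1/l'} ∫_{B(x,r)} |b(x) - b(y)| |f(y)| dy`,
where `l' = l / (l - 1)` is the conjugate exponent of `l`. -/
def fracMaxComm {n : ℕ} {𝕜 : Type*} [RCLike 𝕜] (l : ℝ) (b f : EuclideanSpace ℝ (Fin n) → 𝕜)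
    (x : EuclideanSpace ℝ (Fin n)) : ℝ≥0∞ :=
  ⨆ (r : ℝ) (_ : 0 < r), volume (Metric.closedBall x r) ^ (-(1 / Real.conjExponent l)) *
    ∫⁻ y in Metric.closedBall x r, ‖b x - b y‖ₑ * ‖f y‖ₑ

/-- The operator `T` is bounded from `L^{q⃗₁}(ℝⁿ)` to `L^{q⃗₂}(ℝⁿ)`. -/
def BoundedMixedLp {n : ℕ} {𝕜 : Type*} [RCLike 𝕜] (q₁ q₂ : Fin n → ℝ)
    (T : (EuclideanSpace ℝ (Fin n) → 𝕜) → EuclideanSpace ℝ (Fin n) → ℝ≥0∞) : Prop :=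
  ∃ C : ℝ≥0, ∀ f : EuclideanSpace ℝ (Fin n) → 𝕜, MemMixedLp q₁ f →
    MemMixedLp q₂ (T f) ∧ mixedNorm q₂ (T f) ≤ C * mixedNorm q₁ (fun x => ‖f x‖ₑ)

/-- The operator `T` is bounded from the Herz-Morrey space with parameters `α, lam, p₁, q⃗₁` to
the one with parameters `α, lam, p₂, q⃗₂`. -/
def BoundedHerzMorrey {n : ℕ} {𝕜 : Type*} [RCLike 𝕜] (α lam : ℝ) (p₁ p₂ : ℝ≥0∞)
    (q₁ q₂ : Fin n → ℝ)
    (T : (EuclideanSpace ℝ (Fin n) → 𝕜) → EuclideanSpace ℝ (Fin n) → ℝ≥0∞) : Prop :=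
  ∃ C : ℝ≥0, ∀ f : EuclideanSpace ℝ (Fin n) → 𝕜, MemHerzMorrey α lam p₁ q₁ f →
    MemHerzMorrey α lam p₂ q₂ (T f) ∧
      herzMorreyNorm α lam p₂ q₂ (T f) ≤ C * herzMorreyNorm α lam p₁ q₁ (fun x => ‖f x‖ₑ)

end MixedHerzMorrey

end

/-! Write s₁, s₂ for the sums of the reciprocals of the two exponent vectors, c_k for the mean of b
over B_k and f_j = f χ_j. The relation between the exponents says n/l' = n - s₁ + s₂. On A_k the
three annuli with |j-k| ≤ 1 are handled by the assumed bound on mixed Lebesgue spaces. If |j-k| ≥ 2,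
points of A_k and A_j are more than 2^{max(k,j)-2} apart, so only large balls matter and M_b^l
f_j(x) ≲ 2^{-max(k,j)n/l'} ∫_{A_j} |b(x)-b(y)| |f(y)| dy (`fracMaxComm_le_of_forall_lt_dist`).

In this integral b(x)-b(y) is passed through c_k and c_j. The oscillation bounds needed come from
the boundedness of M_b^l itself, not from a John–Nirenberg inequality. Testing on χ_{B_k} gives
‖(b-c_k)χ_{B_k}‖ ≲ 2^{k s₂} in the target norm (`exists_mixedNorm_osc_le`). Averaging M_b^l f_j over
B_j and applying Hölder gives ∫_{A_j} |b-c_j||f| ≲ 2^{j(n-s₁)} ‖f_j‖ (`exists_setLIntegral_osc_le`).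
The first bound also makes consecutive means differ by O(1), so |c_k-c_j| ≲ |k-j|
(`exists_dyadicMean_sub_le`).

The far interaction thus has weight 2^{-max(k,j)n/l' + j(n-s₁)}(1+|j-k|). The two strict
inequalities on α make it decay geometrically in |j-k| on both sides, with room for the Morrey
factor 2^{-(j-k)λ} (`exists_farWeight_le`). What remains concerns sequences only: such kernels
preserve Morrey sequence norms (`tailNorm_le_of_le_iSup`), and ℓ^{p₁} embeds in ℓ^{p₂}
(`tailNorm_anti`). -/

namespace MixedHerzMorrey

/-! ### Iterated norms on ℝⁿ: monotonicity, Minkowski, homogeneity. -/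

/-- Splitting off the first variable preserves Lebesgue measure. -/
theorem measurePreserving_cons (n : ℕ) :
    MeasurePreserving (fun z : (Fin n → ℝ) × ℝ => (Fin.cons z.2 z.1 : Fin (n + 1) → ℝ))
      (volume.prod volume) volume := by
  have h : (fun z : (Fin n → ℝ) × ℝ => (Fin.cons z.2 z.1 : Fin (n + 1) → ℝ)) =
      (MeasurableEquiv.piFinSuccAbove (fun _ : Fin (n + 1) => ℝ) 0).symm ∘ Prod.swap :=
    funext fun z => (Fin.insertNth_zero' z.2 z.1).symm
  rw [h]
  exact (volume_preserving_piFinSuccAbove (fun _ : Fin (n + 1) => ℝ) 0).symm.comp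
    Measure.measurePreserving_swap

theorem measurable_cons (n : ℕ) :
    Measurable fun z : (Fin n → ℝ) × ℝ => (Fin.cons z.2 z.1 : Fin (n + 1) → ℝ) :=
  (measurePreserving_cons n).measurable

theorem ae_ae_cons {n : ℕ} {P : (Fin (n + 1) → ℝ) → Prop} (h : ∀ᵐ x, P x) :
    ∀ᵐ y : Fin n → ℝ, ∀ᵐ t : ℝ, P (Fin.cons t y) :=
  Measure.ae_ae_of_ae_prod ((measurePreserving_cons n).quasiMeasurePreserving.ae h)

theorem lintegral_cons {n : ℕ} {g : (Fin (n + 1) → ℝ) → ℝ≥0∞} (hg : Measurable g) :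
    ∫⁻ x, g x = ∫⁻ y : Fin n → ℝ, ∫⁻ t : ℝ, g (Fin.cons t y) := by
  rw [← (measurePreserving_cons n).lintegral_comp hg]
  exact lintegral_prod _ (hg.comp (measurable_cons n)).aemeasurable

theorem measurable_inner_norm {n : ℕ} (q : ℝ) {g : (Fin (n + 1) → ℝ) → ℝ≥0∞}
    (hg : Measurable g) :
    Measurable fun y : Fin n → ℝ => (∫⁻ t : ℝ, g (Fin.cons t y) ^ q) ^ (1 / q) :=
  (Measurable.lintegral_prod_right' (ν := (volume : Measure ℝ))
    (f := fun z : (Fin n → ℝ) × ℝ => g (Fin.cons z.2 z.1) ^ q)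
    ((hg.comp (measurable_cons n)).pow_const q)).pow_const _

theorem measurable_cons_left {n : ℕ} (y : Fin n → ℝ) :
    Measurable fun t : ℝ => (Fin.cons t y : Fin (n + 1) → ℝ) :=
  (measurable_cons n).comp measurable_prodMk_left

theorem iterNorm_mono_ae : ∀ {n : ℕ} {q : Fin n → ℝ}, (∀ i, 0 ≤ q i) →
    ∀ {f g : (Fin n → ℝ) → ℝ≥0∞}, f ≤ᵐ[volume] g → iterNorm n q f ≤ iterNorm n q g
  | 0, _, _, f, g, h => by
    -- In dimension zero the volume is a Dirac mass, so an almost everywhere inequality holds at the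
    -- only point.
    rw [Filter.EventuallyLE, Measure.volume_pi_eq_dirac Fin.elim0, ae_dirac_eq] at h
    exact h
  | n + 1, q, hq, f, g, h => by
    refine iterNorm_mono_ae (fun i => hq i.succ) ?_
    filter_upwards [ae_ae_cons h] with y hy
    have h0 := hq 0
    refine ENNReal.rpow_le_rpow (lintegral_mono_ae ?_) (by positivity)
    filter_upwards [hy] with t ht
    exact ENNReal.rpow_le_rpow ht h0

theorem iterNorm_congr_ae {n : ℕ} {q : Fin n → ℝ} (hq : ∀ i, 0 ≤ q i)
    {f g : (Fin n → ℝ) → ℝ≥0∞} (h : f =ᵐ[volume] g) : iterNorm n q f = iterNorm n q g :=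
  le_antisymm (iterNorm_mono_ae hq h.le) (iterNorm_mono_ae hq h.symm.le)

/-- Minkowski in the first variable holds for each fixed value of the others; monotonicity of the
outer norm then allows induction on the dimension. -/
theorem iterNorm_add_le_of_measurable : ∀ {n : ℕ} {q : Fin n → ℝ}, (∀ i, 1 ≤ q i) →
    ∀ {f g : (Fin n → ℝ) → ℝ≥0∞}, Measurable f → Measurable g →
      iterNorm n q (fun x => f x + g x) ≤ iterNorm n q f + iterNorm n q g
  | 0, _, _, f, g, _, _ => le_rfl
  | n + 1, q, hq, f, g, hf, hg => by
    refine le_trans (iterNorm_mono_ae (fun i => zero_le_one.trans (hq i.succ))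
      (Filter.Eventually.of_forall fun y => ?_))
      (iterNorm_add_le_of_measurable (fun i => hq i.succ) (measurable_inner_norm (q 0) hf)
        (measurable_inner_norm (q 0) hg))
    exact ENNReal.lintegral_Lp_add_le (hf.comp (measurable_cons_left y)).aemeasurable
      (hg.comp (measurable_cons_left y)).aemeasurable (hq 0)

theorem iterNorm_add_le {n : ℕ} {q : Fin n → ℝ} (hq : ∀ i, 1 ≤ q i)
    {f g : (Fin n → ℝ) → ℝ≥0∞} (hf : AEMeasurable f) (hg : AEMeasurable g) :
    iterNorm n q (fun x => f x + g x) ≤ iterNorm n q f + iterNorm n q g := by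
  have hq0 : ∀ i, 0 ≤ q i := fun i => zero_le_one.trans (hq i)
  rw [iterNorm_congr_ae hq0 hf.ae_eq_mk, iterNorm_congr_ae hq0 hg.ae_eq_mk]
  refine (iterNorm_congr_ae hq0 (hf.ae_eq_mk.add hg.ae_eq_mk)).trans_le ?_
  exact iterNorm_add_le_of_measurable hq hf.measurable_mk hg.measurable_mk

theorem lintegral_const_mul_rpow {g : ℝ → ℝ≥0∞} {q : ℝ} (hq : 0 < q) {c : ℝ≥0∞} (hc : c ≠ ∞) :
    (∫⁻ t, (c * g t) ^ q) ^ (1 / q) = c * (∫⁻ t, g t ^ q) ^ (1 / q) := by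
  simp_rw [ENNReal.mul_rpow_of_nonneg _ _ hq.le]
  rw [lintegral_const_mul' _ _ (ENNReal.rpow_ne_top_of_nonneg hq.le hc),
    ENNReal.mul_rpow_of_nonneg _ _ (by positivity), ← ENNReal.rpow_mul, mul_one_div_cancel hq.ne',
    ENNReal.rpow_one]

theorem iterNorm_const_mul : ∀ {n : ℕ} {q : Fin n → ℝ}, (∀ i, 0 < q i) →
    ∀ (g : (Fin n → ℝ) → ℝ≥0∞) {c : ℝ≥0∞}, c ≠ ∞ →
      iterNorm n q (fun x => c * g x) = c * iterNorm n q g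
  | 0, _, _, _, _, _ => rfl
  | n + 1, q, hq, g, c, hc => by
    rw [iterNorm, iterNorm, ← iterNorm_const_mul (q := Fin.tail q) (fun i => hq i.succ) _ hc]
    simp_rw [lintegral_const_mul_rpow (hq 0) hc]

/-! ### Cubes: norm of the indicator and Hölder's inequality, one variable at a time. -/

/-- The cube `[-R, R]ⁿ`. -/
def cube (n : ℕ) (R : ℝ) : Set (Fin n → ℝ) := {x | ∀ i, x i ∈ Icc (-R) R}

theorem measurableSet_cube (n : ℕ) (R : ℝ) : MeasurableSet (cube n R) := by
  have : cube n R = Set.pi univ fun _ => Icc (-R) R := by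
    ext; simp only [cube, mem_pi, mem_ofPred_eq, mem_univ, true_imp_iff]
  rw [this]
  exact MeasurableSet.univ_pi fun _ => measurableSet_Icc

theorem cons_mem_cube {n : ℕ} {R t : ℝ} {y : Fin n → ℝ} :
    (Fin.cons t y : Fin (n + 1) → ℝ) ∈ cube (n + 1) R ↔ t ∈ Icc (-R) R ∧ y ∈ cube n R := by
  simp only [cube, mem_ofPred_eq, Fin.forall_fin_succ, Fin.cons_zero, Fin.cons_succ]

theorem volume_Icc_neg (R : ℝ) : volume (Icc (-R) R) = ENNReal.ofReal (2 * R) := by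
  rw [Real.volume_Icc]; congr 1; ring

theorem lintegral_indicator_one_mul_rpow {q R : ℝ} (hq : 0 < q) (c : ℝ≥0∞) :
    (∫⁻ t, ((Icc (-R) R).indicator (fun _ => c) t) ^ q) ^ (1 / q)
      = ENNReal.ofReal (2 * R) ^ (1 / q) * c := by
  have : ∀ t, ((Icc (-R) R).indicator (fun _ => c) t) ^ q
      = (Icc (-R) R).indicator (fun _ => c ^ q) t := fun t => by
    by_cases ht : t ∈ Icc (-R) R <;> simp [ht, hq]
  simp_rw [this]
  rw [lintegral_indicator_const measurableSet_Icc, volume_Icc_neg,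
    ENNReal.mul_rpow_of_nonneg _ _ (by positivity), ← ENNReal.rpow_mul, mul_one_div_cancel hq.ne',
    ENNReal.rpow_one, mul_comm]

/-- The indicator of a cube is a product over the variables, so each integration contributes one
factor. This is the reason to work with cubes before balls. -/
theorem iterNorm_cube : ∀ {n : ℕ} {q : Fin n → ℝ}, (∀ i, 0 < q i) → ∀ {R : ℝ}, 0 < R →
    iterNorm n q ((cube n R).indicator 1) = ENNReal.ofReal (2 * R) ^ (∑ i, 1 / q i)
  | 0, _, _, R, _ => by
    have : (Fin.elim0 : Fin 0 → ℝ) ∈ cube 0 R := fun i => i.elim0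
    simp [iterNorm, this]
  | n + 1, q, hq, R, hR => by
    have key : ∀ (y : Fin n → ℝ) (t : ℝ),
        (cube (n + 1) R).indicator (1 : (Fin (n + 1) → ℝ) → ℝ≥0∞) (Fin.cons t y)
        = (Icc (-R) R).indicator (fun _ => (cube n R).indicator (1 : (Fin n → ℝ) → ℝ≥0∞) y) t := fun y t => by
      by_cases ht : t ∈ Icc (-R) R <;> by_cases hy : y ∈ cube n R <;>
        simp only [indicator, cons_mem_cube, ht, hy] <;> simp
    rw [iterNorm]
    simp_rw [key, lintegral_indicator_one_mul_rpow (hq 0)]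
    rw [iterNorm_const_mul (q := Fin.tail q) (fun i => hq i.succ) _
      (ENNReal.rpow_ne_top_of_nonneg (by have := hq 0; positivity) ENNReal.ofReal_ne_top),
      iterNorm_cube (q := Fin.tail q) (fun i => hq i.succ) hR, Fin.sum_univ_succ,
      ENNReal.rpow_add _ _ (by simpa using hR) ENNReal.ofReal_ne_top]
    rfl

theorem setLIntegral_le_rpow {g : ℝ → ℝ≥0∞} (hg : Measurable g) {q R : ℝ} (hq : 1 ≤ q) :
    ∫⁻ t in Icc (-R) R, g t
      ≤ ENNReal.ofReal (2 * R) ^ (1 - 1 / q) * (∫⁻ t, g t ^ q) ^ (1 / q) := by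
  have h := eLpNorm'_le_eLpNorm'_mul_rpow_measure_univ
    (μ := (volume : Measure ℝ).restrict (Icc (-R) R)) zero_lt_one hq hg.aestronglyMeasurable
  simp only [eLpNorm', enorm_eq_self, ENNReal.rpow_one, div_one, Measure.restrict_apply_univ,
    volume_Icc_neg] at h
  rw [mul_comm]
  refine h.trans ?_
  gcongr
  exact Measure.restrict_le_self

/-- Tonelli, then Hölder against 1 on [-R, R] in each variable: variable i costs (2R)^{1-1/q_i}. -/
theorem setLIntegral_cube_le_of_measurable : ∀ {n : ℕ} {q : Fin n → ℝ}, (∀ i, 1 ≤ q i) →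
    ∀ {R : ℝ}, 0 < R → ∀ {g : (Fin n → ℝ) → ℝ≥0∞}, Measurable g →
      ∫⁻ x, (cube n R).indicator g x
        ≤ ENNReal.ofReal (2 * R) ^ (n - ∑ i, 1 / q i) * iterNorm n q g
  | 0, _, _, R, _, g, _ => by
    have : (Fin.elim0 : Fin 0 → ℝ) ∈ cube 0 R := fun i => i.elim0
    rw [Measure.volume_pi_eq_dirac Fin.elim0, lintegral_dirac]
    simp [iterNorm, this]
  | n + 1, q, hq, R, hR, g, hg => by
    have hR2 : ENNReal.ofReal (2 * R) ≠ 0 := by simpa using hR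
    have hc : ENNReal.ofReal (2 * R) ^ (1 - 1 / q 0) ≠ ∞ := by
      refine ENNReal.rpow_ne_top_of_nonneg ?_ ENNReal.ofReal_ne_top
      rw [sub_nonneg, div_le_one (zero_lt_one.trans_le (hq 0))]
      exact hq 0
    have key : ∀ (y : Fin n → ℝ) (t : ℝ), (cube (n + 1) R).indicator g (Fin.cons t y)
        = (Icc (-R) R).indicator (fun t => (cube n R).indicator (fun y => g (Fin.cons t y)) y) t :=
      fun y t => by
      by_cases ht : t ∈ Icc (-R) R <;> by_cases hy : y ∈ cube n R <;>
        simp only [indicator, cons_mem_cube, ht, hy] <;> simp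
    rw [lintegral_cons (hg.indicator (measurableSet_cube _ _))]
    calc ∫⁻ y : Fin n → ℝ, ∫⁻ t : ℝ, (cube (n + 1) R).indicator g (Fin.cons t y)
        ≤ ∫⁻ y : Fin n → ℝ, (cube n R).indicator (fun y => ENNReal.ofReal (2 * R) ^ (1 - 1 / q 0) *
            (∫⁻ t : ℝ, g (Fin.cons t y) ^ q 0) ^ (1 / q 0)) y := by
          refine lintegral_mono fun y => ?_
          simp_rw [key]
          rw [lintegral_indicator measurableSet_Icc]
          by_cases hy : y ∈ cube n R
          · simpa [hy] using setLIntegral_le_rpow (hg.comp (measurable_cons_left y)) (hq 0)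
          · simp [hy]
      _ = ENNReal.ofReal (2 * R) ^ (1 - 1 / q 0) * ∫⁻ y : Fin n → ℝ, (cube n R).indicator (fun y =>
            (∫⁻ t : ℝ, g (Fin.cons t y) ^ q 0) ^ (1 / q 0)) y := by
          rw [← lintegral_const_mul' _ _ hc]
          refine lintegral_congr fun y => ?_
          by_cases hy : y ∈ cube n R <;> simp [hy]
      _ ≤ ENNReal.ofReal (2 * R) ^ (1 - 1 / q 0) *
            (ENNReal.ofReal (2 * R) ^ (n - ∑ i, 1 / Fin.tail q i) * iterNorm n (Fin.tail q) _) := by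
          gcongr
          exact setLIntegral_cube_le_of_measurable (fun i => hq i.succ) hR
            (measurable_inner_norm (q 0) hg)
      _ = _ := by
          rw [← mul_assoc, ← ENNReal.rpow_add _ _ hR2 ENNReal.ofReal_ne_top, Fin.sum_univ_succ]
          rw [iterNorm]
          congr 2
          simp only [Fin.tail]
          push_cast
          ring

theorem setLIntegral_cube_le {n : ℕ} {q : Fin n → ℝ} (hq : ∀ i, 1 ≤ q i) {R : ℝ} (hR : 0 < R)
    {g : (Fin n → ℝ) → ℝ≥0∞} (hg : AEMeasurable g) :
    ∫⁻ x in cube n R, g x ≤ ENNReal.ofReal (2 * R) ^ (n - ∑ i, 1 / q i) * iterNorm n q g := by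
  rw [iterNorm_congr_ae (fun i => zero_le_one.trans (hq i)) hg.ae_eq_mk,
    lintegral_congr_ae (ae_restrict_of_ae hg.ae_eq_mk),
    ← lintegral_indicator (measurableSet_cube _ _)]
  exact setLIntegral_cube_le_of_measurable hq hR hg.measurable_mk

/-! ### Transfer to Euclidean space and to balls, which lie in cubes. -/

section mixedNorm

variable {n : ℕ} {q : Fin n → ℝ} {f g : EuclideanSpace ℝ (Fin n) → ℝ≥0∞}

theorem mixedNorm_mono_ae (hq : ∀ i, 0 ≤ q i) (h : f ≤ᵐ[volume] g) :
    mixedNorm q f ≤ mixedNorm q g :=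
  iterNorm_mono_ae hq ((PiLp.volume_preserving_toLp (Fin n)).quasiMeasurePreserving.ae h)

theorem mixedNorm_mono (hq : ∀ i, 0 ≤ q i) (h : ∀ x, f x ≤ g x) :
    mixedNorm q f ≤ mixedNorm q g :=
  mixedNorm_mono_ae hq (Filter.Eventually.of_forall h)

theorem aemeasurable_comp_toLp (hf : AEMeasurable f) :
    AEMeasurable fun x : Fin n → ℝ => f (WithLp.toLp 2 x) :=
  hf.comp_quasiMeasurePreserving (PiLp.volume_preserving_toLp (Fin n)).quasiMeasurePreserving

theorem mixedNorm_add_le (hq : ∀ i, 1 ≤ q i) (hf : AEMeasurable f) (hg : AEMeasurable g) :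
    mixedNorm q (fun x => f x + g x) ≤ mixedNorm q f + mixedNorm q g :=
  iterNorm_add_le hq (aemeasurable_comp_toLp hf) (aemeasurable_comp_toLp hg)

theorem mixedNorm_const_mul (hq : ∀ i, 0 < q i) (f : EuclideanSpace ℝ (Fin n) → ℝ≥0∞) {c : ℝ≥0∞}
    (hc : c ≠ ∞) : mixedNorm q (fun x => c * f x) = c * mixedNorm q f :=
  iterNorm_const_mul hq _ hc

theorem mem_cube_of_mem_closedBall {R : ℝ} {x : Fin n → ℝ}
    (hx : WithLp.toLp 2 x ∈ Metric.closedBall (0 : EuclideanSpace ℝ (Fin n)) R) :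
    x ∈ cube n R := fun i => by
  have h := (PiLp.norm_apply_le (WithLp.toLp 2 x) i).trans (mem_closedBall_zero_iff.1 hx)
  exact abs_le.1 (by simpa using h)

theorem mixedNorm_closedBall_le (hq : ∀ i, 0 < q i) {R : ℝ} (hR : 0 < R) :
    mixedNorm q ((Metric.closedBall 0 R).indicator 1) ≤ ENNReal.ofReal (2 * R) ^ (∑ i, 1 / q i) := by
  rw [← iterNorm_cube hq hR]
  refine iterNorm_mono_ae (fun i => (hq i).le) (Filter.Eventually.of_forall fun x => ?_)
  by_cases hx : WithLp.toLp 2 x ∈ Metric.closedBall (0 : EuclideanSpace ℝ (Fin n)) R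
  · simp [hx, mem_cube_of_mem_closedBall hx]
  · simp [hx]

/-- Hölder's inequality on a ball centred at the origin. -/
theorem setLIntegral_closedBall_le (hq : ∀ i, 1 ≤ q i) {R : ℝ} (hR : 0 < R)
    (hg : AEMeasurable g) :
    ∫⁻ x in Metric.closedBall 0 R, g x
      ≤ ENNReal.ofReal (2 * R) ^ (n - ∑ i, 1 / q i) * mixedNorm q g := by
  refine le_trans ?_ (setLIntegral_cube_le hq hR (aemeasurable_comp_toLp hg))
  rw [← (PiLp.volume_preserving_toLp (Fin n)).setLIntegral_comp_preimage_emb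
    (MeasurableEquiv.toLp 2 (Fin n → ℝ)).measurableEmbedding]
  exact lintegral_mono_set fun x hx => mem_cube_of_mem_closedBall hx

end mixedNorm

/-! ### Powers of two and two-sided geometric series. -/

/-- Real powers of two in `[0,∞]`. -/
noncomputable def twoPow (x : ℝ) : ℝ≥0∞ := (2 : ℝ≥0∞) ^ x

theorem twoPow_add (x y : ℝ) : twoPow (x + y) = twoPow x * twoPow y :=
  ENNReal.rpow_add _ _ two_ne_zero ENNReal.ofNat_ne_top

theorem twoPow_zero : twoPow 0 = 1 := ENNReal.rpow_zero

theorem twoPow_ne_top (x : ℝ) : twoPow x ≠ ∞ := by simp [twoPow, ENNReal.rpow_eq_top_iff]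

theorem twoPow_mono {x y : ℝ} (h : x ≤ y) : twoPow x ≤ twoPow y :=
  ENNReal.rpow_le_rpow_of_exponent_le one_le_two h

theorem twoPow_rpow (x y : ℝ) : twoPow x ^ y = twoPow (x * y) := (ENNReal.rpow_mul _ _ _).symm

theorem twoPow_neg_mul_cancel (x : ℝ) : twoPow (-x) * twoPow x = 1 := by
  rw [← twoPow_add, neg_add_cancel, twoPow_zero]

theorem le_twoPow_mul_of_twoPow_neg_mul_le {x : ℝ} {a c : ℝ≥0∞} (h : twoPow (-x) * a ≤ c) :
    a ≤ twoPow x * c := by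
  calc a = twoPow x * (twoPow (-x) * a) := by
        rw [← mul_assoc, mul_comm (twoPow x), twoPow_neg_mul_cancel, one_mul]
    _ ≤ _ := by gcongr

theorem ofReal_two_zpow (k : ℤ) : ENNReal.ofReal ((2 : ℝ) ^ k) = twoPow k := by
  rw [← Real.rpow_intCast, twoPow, ← ENNReal.ofReal_rpow_of_pos two_pos, ENNReal.ofReal_ofNat]

theorem tsum_twoPow_neg_abs_ne_top {e : ℝ} (he : 0 < e) :
    ∑' m : ℤ, twoPow (-(e * |(m : ℝ)|)) ≠ ∞ := by
  have hnat : ∑' m : ℕ, twoPow (-(e * (m : ℝ))) ≠ ∞ := by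
    have : ∀ m : ℕ, twoPow (-(e * (m : ℝ))) = twoPow (-e) ^ m := fun m => by
      rw [← ENNReal.rpow_natCast, twoPow_rpow]; ring_nf
    simp_rw [this]
    rw [ENNReal.tsum_geometric, ENNReal.inv_ne_top]
    refine (tsub_pos_of_lt ?_).ne'
    rw [← twoPow_zero]
    exact ENNReal.rpow_lt_rpow_of_exponent_lt ENNReal.one_lt_two ENNReal.ofNat_ne_top (by linarith)
  -- ℤ is covered by two copies of ℕ; zero is counted twice, hence only an inequality.
  have h : ∑' m : ℤ, twoPow (-(e * |(m : ℝ)|))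
      ≤ ∑' z : ℕ ⊕ ℕ, twoPow (-(e *
          |((Sum.elim (fun a : ℕ => (a : ℤ)) (fun a : ℕ => -(a : ℤ)) z : ℤ) : ℝ)|)) := by
    refine ENNReal.tsum_le_tsum_comp_of_surjective
      (f := Sum.elim (fun a : ℕ => (a : ℤ)) (fun a : ℕ => -(a : ℤ))) ?_
      (fun m : ℤ => twoPow (-(e * |(m : ℝ)|)))
    intro m
    obtain ⟨k, rfl | rfl⟩ := m.eq_nat_or_neg
    · exact ⟨Sum.inl k, rfl⟩
    · exact ⟨Sum.inr k, rfl⟩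
  refine ne_top_of_le_ne_top ?_ h
  rw [ENNReal.summable.tsum_sum ENNReal.summable]
  simp only [Sum.elim_inl, Sum.elim_inr, Int.cast_neg, Int.cast_natCast, abs_neg, Nat.abs_cast]
  exact ENNReal.add_ne_top.2 ⟨hnat, hnat⟩

/-! ### Morrey sequence norms. -/

/-- The partial `ℓᵖ` norm up to the index `k₀`. -/
noncomputable def tailNorm (p : ℝ≥0∞) (a : ℤ → ℝ≥0∞) (k₀ : ℤ) : ℝ≥0∞ :=
  if p = ∞ then ⨆ k : Iic k₀, a k else (∑' k : Iic k₀, a k ^ p.toReal) ^ (1 / p.toReal)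

theorem herzMorreyNorm_eq {n : ℕ} (α lam : ℝ) (p : ℝ≥0∞) (q : Fin n → ℝ)
    (g : EuclideanSpace ℝ (Fin n) → ℝ≥0∞) :
    herzMorreyNorm α lam p q g = ⨆ k₀ : ℤ, twoPow (-(k₀ * lam)) *
      tailNorm p (fun k => twoPow (k * α) * mixedNorm q ((annulus n k).indicator g)) k₀ := by
  refine iSup_congr fun k₀ => ?_
  congr 1
  rw [tailNorm]
  refine if_congr Iff.rfl rfl ?_
  congr 1
  refine tsum_congr fun k => ?_
  rw [ENNReal.mul_rpow_of_nonneg _ _ ENNReal.toReal_nonneg, twoPow_rpow, twoPow]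

theorem le_tailNorm {p : ℝ≥0∞} (hp : 0 < p) (a : ℤ → ℝ≥0∞) {k k₀ : ℤ} (hk : k ≤ k₀) :
    a k ≤ tailNorm p a k₀ := by
  rw [tailNorm]
  split_ifs with h
  · exact le_iSup (fun k : Iic k₀ => a k) ⟨k, hk⟩
  · have hp' := ENNReal.toReal_pos hp.ne' h
    rw [one_div, ENNReal.le_rpow_inv_iff hp']
    exact ENNReal.le_tsum (f := fun k : Iic k₀ => a k ^ p.toReal) ⟨k, hk⟩

/-- With S the ℓ^{p₁} norm, every term is at most S, so a_k^{p₂} ≤ a_k^{p₁} S^{p₂-p₁}; summing gives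
S^{p₂}. -/
theorem tailNorm_anti {p₁ p₂ : ℝ≥0∞} (hp₁ : 0 < p₁) (hp : p₁ ≤ p₂) (a : ℤ → ℝ≥0∞) (k₀ : ℤ) :
    tailNorm p₂ a k₀ ≤ tailNorm p₁ a k₀ := by
  have hle := fun k : Iic k₀ => le_tailNorm hp₁ a k.2
  rcases eq_or_ne p₂ ∞ with rfl | h2
  · rw [tailNorm, if_pos rfl]
    exact iSup_le hle
  have h1 : p₁ ≠ ∞ := ne_top_of_le_ne_top h2 hp
  have hp₁' := ENNReal.toReal_pos hp₁.ne' h1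
  have hp' := ENNReal.toReal_mono h2 hp
  have hp₂' := hp₁'.trans_le hp'
  set S := tailNorm p₁ a k₀ with hS
  have hSp : S ^ p₁.toReal = ∑' k : Iic k₀, a k ^ p₁.toReal := by
    rw [hS, tailNorm, if_neg h1, ← ENNReal.rpow_mul, one_div_mul_cancel hp₁'.ne', ENNReal.rpow_one]
  rw [tailNorm, if_neg h2, one_div, ENNReal.rpow_inv_le_iff hp₂']
  have split : ∀ x : ℝ≥0∞, x ^ p₂.toReal = x ^ p₁.toReal * x ^ (p₂.toReal - p₁.toReal) := fun x => by
    rw [← ENNReal.rpow_add_of_nonneg _ _ hp₁'.le (sub_nonneg.2 hp'), add_sub_cancel]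
  calc ∑' k : Iic k₀, a k ^ p₂.toReal
      ≤ ∑' k : Iic k₀, a k ^ p₁.toReal * S ^ (p₂.toReal - p₁.toReal) := by
        refine ENNReal.tsum_le_tsum fun k => ?_
        rw [split]
        exact mul_le_mul_right (ENNReal.rpow_le_rpow (hle k) (sub_nonneg.2 hp')) _
    _ = S ^ p₂.toReal := by rw [ENNReal.tsum_mul_right, ← hSp, ← split]

theorem tsum_Iic_shift (g : ℤ → ℝ≥0∞) (k₀ m : ℤ) :
    ∑' k : Iic k₀, g (k + m) = ∑' k : Iic (k₀ + m), g k := by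
  let e : Iic k₀ ≃ Iic (k₀ + m) :=
    (Equiv.addRight m).subtypeEquiv fun k => by simp
  exact e.tsum_eq fun k : Iic (k₀ + m) => g k

/-- Sequences controlled by an exponentially decaying maximal average are bounded in Morrey
sequence spaces. -/
theorem tailNorm_le_of_le_iSup {p : ℝ≥0∞} (hp : 0 < p) {lam e : ℝ} (hlam : 0 ≤ lam) (he : 0 < e)
    {C : ℝ≥0∞} (hC : C ≠ ∞) : ∃ C' : ℝ≥0∞, C' ≠ ∞ ∧ ∀ (a d : ℤ → ℝ≥0∞) (A : ℝ≥0∞),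
      (∀ k₀ : ℤ, tailNorm p a k₀ ≤ twoPow (k₀ * lam) * A) →
      (∀ k : ℤ, d k ≤ C * ⨆ m : ℤ, twoPow (-(e * |(m : ℝ)|) - m * lam) * a (k + m)) →
      ∀ k₀ : ℤ, tailNorm p d k₀ ≤ twoPow (k₀ * lam) * (C' * A) := by
  rcases eq_or_ne p ∞ with rfl | hpt
  · refine ⟨C, hC, fun a d A ha hd k₀ => ?_⟩
    rw [tailNorm, if_pos rfl]
    refine iSup_le fun k => (hd k).trans ?_
    rw [mul_left_comm]
    gcongr
    refine iSup_le fun m => ?_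
    calc twoPow (-(e * |(m : ℝ)|) - m * lam) * a (k + m)
        ≤ twoPow (-(e * |(m : ℝ)|) - m * lam) * (twoPow ((k + m : ℤ) * lam) * A) := by
          gcongr
          exact (le_tailNorm hp a le_rfl).trans (ha _)
      _ = twoPow (-(e * |(m : ℝ)|) + (k : ℤ) * lam) * A := by
          rw [← mul_assoc, ← twoPow_add]
          congr 2
          push_cast
          ring
      _ ≤ twoPow (k₀ * lam) * A := by
          gcongr
          refine twoPow_mono ?_
          have h1 : ((k : ℤ) : ℝ) * lam ≤ k₀ * lam := by
            gcongr
            exact_mod_cast k.2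
          have h2 : 0 ≤ e * |(m : ℝ)| := by positivity
          linarith
  · have hp' := ENNReal.toReal_pos hp.ne' hpt
    set r := p.toReal
    set Z := ∑' m : ℤ, twoPow (-(e * r * |(m : ℝ)|)) with hZ
    have hZt : Z ≠ ∞ := tsum_twoPow_neg_abs_ne_top (by positivity)
    refine ⟨C * Z ^ r⁻¹, ENNReal.mul_ne_top hC
      (ENNReal.rpow_ne_top_of_nonneg (by positivity) hZt), fun a d A ha hd k₀ => ?_⟩
    have ha' : ∀ k₀ : ℤ, ∑' k : Iic k₀, a k ^ r ≤ twoPow (k₀ * lam * r) * A ^ r := fun k₀ => by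
      have := ha k₀
      rw [tailNorm, if_neg hpt, one_div, ENNReal.rpow_inv_le_iff hp',
        ENNReal.mul_rpow_of_nonneg _ _ hp'.le, twoPow_rpow] at this
      exact this
    rw [tailNorm, if_neg hpt, one_div p.toReal, ENNReal.rpow_inv_le_iff hp']
    calc ∑' k : Iic k₀, d k ^ r
        ≤ ∑' k : Iic k₀, C ^ r * ∑' m : ℤ,
            twoPow ((-(e * |(m : ℝ)|) - m * lam) * r) * a (k + m) ^ r := by
          refine ENNReal.tsum_le_tsum fun k => ?_
          calc d k ^ r ≤ (C * ⨆ m : ℤ, twoPow (-(e * |(m : ℝ)|) - m * lam) * a (k + m)) ^ r := by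
                gcongr
                exact hd k
            _ ≤ _ := by
                rw [ENNReal.mul_rpow_of_nonneg _ _ hp'.le]
                gcongr
                -- The r-th power of a supremum is at most the sum of the r-th powers for every r >
                -- 0, so r < 1 needs no separate argument; this is why the hypothesis carries a
                -- supremum.
                rw [← ENNReal.le_rpow_inv_iff hp']
                refine iSup_le fun m => ?_
                rw [ENNReal.le_rpow_inv_iff hp', ENNReal.mul_rpow_of_nonneg _ _ hp'.le, twoPow_rpow]
                exact ENNReal.le_tsum (f := fun m : ℤ =>
                  twoPow ((-(e * |(m : ℝ)|) - m * lam) * r) * a (k + m) ^ r) m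
      -- After exchanging the sums, the shift by m moves the cut-off from k₀ to k₀ + m.
      _ = C ^ r * ∑' m : ℤ, twoPow ((-(e * |(m : ℝ)|) - m * lam) * r) *
            ∑' k : Iic (k₀ + m), a k ^ r := by
          rw [ENNReal.tsum_mul_left, ENNReal.tsum_comm]
          congr 1
          refine tsum_congr fun m => ?_
          rw [ENNReal.tsum_mul_left, tsum_Iic_shift (fun k => a k ^ r)]
      _ ≤ C ^ r * ∑' m : ℤ, twoPow ((-(e * |(m : ℝ)|) - m * lam) * r) *
            (twoPow ((k₀ + m : ℤ) * lam * r) * A ^ r) := by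
          gcongr with m
          exact ha' _
      -- The moved cut-off costs 2^{mλr}, which the factor 2^{-mλr} of the kernel cancels exactly.
      _ = C ^ r * ∑' m : ℤ, twoPow (-(e * r * |(m : ℝ)|)) * (twoPow (k₀ * lam * r) * A ^ r) := by
          congr 1
          refine tsum_congr fun m => ?_
          rw [← mul_assoc, ← mul_assoc, ← twoPow_add, ← twoPow_add]
          congr 2
          push_cast
          ring
      _ = _ := by
          rw [ENNReal.tsum_mul_right, ENNReal.mul_rpow_of_nonneg _ _ hp'.le,
            ENNReal.mul_rpow_of_nonneg _ _ hp'.le, ENNReal.mul_rpow_of_nonneg _ _ hp'.le,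
            twoPow_rpow, ← ENNReal.rpow_mul, inv_mul_cancel₀ hp'.ne', ENNReal.rpow_one, ← hZ]
          ring

/-- Half of the decay pays for summability; the other half stays inside the supremum. -/
theorem tsum_mul_le_mul_iSup {e : ℝ} (x : ℤ → ℝ≥0∞) :
    ∑' m : ℤ, twoPow (-(2 * e * |(m : ℝ)|)) * x m
      ≤ (∑' m : ℤ, twoPow (-(e * |(m : ℝ)|))) * ⨆ m : ℤ, twoPow (-(e * |(m : ℝ)|)) * x m := by
  rw [← ENNReal.tsum_mul_right]
  refine ENNReal.tsum_le_tsum fun m => ?_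
  calc twoPow (-(2 * e * |(m : ℝ)|)) * x m
      = twoPow (-(e * |(m : ℝ)|)) * (twoPow (-(e * |(m : ℝ)|)) * x m) := by
        rw [← mul_assoc, ← twoPow_add]
        congr 2
        ring
    _ ≤ _ := by
        gcongr
        exact le_iSup (fun m : ℤ => twoPow (-(e * |(m : ℝ)|)) * x m) m

/-- A linear factor is absorbed by an exponential. -/
theorem exists_one_add_le_twoPow {e : ℝ} (he : 0 < e) :
    ∃ C : ℝ≥0∞, C ≠ ∞ ∧ ∀ t : ℝ, 0 ≤ t → ENNReal.ofReal (1 + t) ≤ C * twoPow (e * t) := by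
  have hL : 0 < e * Real.log 2 := mul_pos he (Real.log_pos one_lt_two)
  refine ⟨ENNReal.ofReal (1 + 1 / (e * Real.log 2)), ENNReal.ofReal_ne_top, fun t ht => ?_⟩
  have h2 : twoPow (e * t) = ENNReal.ofReal ((2 : ℝ) ^ (e * t)) := by
    rw [twoPow, ← ENNReal.ofReal_rpow_of_pos two_pos]
    norm_num
  rw [h2, ← ENNReal.ofReal_mul (by positivity)]
  refine ENNReal.ofReal_le_ofReal ?_
  -- This is 1 + x ≤ exp x at x = e t log 2.
  have h3 : 1 + e * Real.log 2 * t ≤ (2 : ℝ) ^ (e * t) := by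
    rw [Real.rpow_def_of_pos two_pos]
    have := Real.add_one_le_exp (Real.log 2 * (e * t))
    linarith
  calc 1 + t ≤ (1 + 1 / (e * Real.log 2)) * (1 + e * Real.log 2 * t) := by
        have : (1 + 1 / (e * Real.log 2)) * (1 + e * Real.log 2 * t)
          = 1 + t + (1 / (e * Real.log 2) + e * Real.log 2 * t) := by field_simp; ring
        rw [this]
        have : 0 ≤ 1 / (e * Real.log 2) + e * Real.log 2 * t := by positivity
        linarith
    _ ≤ _ := by gcongr

/-! ### Dyadic annuli and the distance between separated ones. -/

section Geometry

variable {n : ℕ}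

theorem mem_annulus {k : ℤ} {x : EuclideanSpace ℝ (Fin n)} :
    x ∈ annulus n k ↔ (2 : ℝ) ^ (k - 1) < ‖x‖ ∧ ‖x‖ ≤ (2 : ℝ) ^ k := by
  simp only [annulus, mem_sdiff, mem_closedBall_zero_iff, not_le]
  exact and_comm

theorem measurableSet_annulus (k : ℤ) : MeasurableSet (annulus n k) :=
  Metric.isClosed_closedBall.measurableSet.diff Metric.isClosed_closedBall.measurableSet

theorem annulus_subset (k : ℤ) : annulus n k ⊆ Metric.closedBall 0 ((2 : ℝ) ^ k) := sdiff_subset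

theorem exists_mem_annulus {x : EuclideanSpace ℝ (Fin n)} (hx : x ≠ 0) : ∃ k, x ∈ annulus n k := by
  obtain ⟨k, hk⟩ := exists_mem_Ioc_zpow (norm_pos_iff.2 hx) (one_lt_two (α := ℝ))
  refine ⟨k + 1, mem_annulus.2 ⟨?_, hk.2⟩⟩
  rw [add_sub_cancel_right]
  exact hk.1

theorem two_zpow_eq (k : ℤ) : (2 : ℝ) ^ (k - 1) = 2 ^ (k - 2) + 2 ^ (k - 2) := by
  rw [← two_mul, ← zpow_one_add₀ two_ne_zero]
  congr 1
  ring

theorem lt_dist_of_inner {j k : ℤ} (h : j ≤ k - 2) {x y : EuclideanSpace ℝ (Fin n)}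
    (hx : x ∈ annulus n k) (hy : y ∈ annulus n j) : (2 : ℝ) ^ (max k j - 2) < dist x y := by
  rw [max_eq_left (by omega)]
  have h1 := (mem_annulus.1 hx).1
  have h2 := (mem_annulus.1 hy).2
  have h3 : (2 : ℝ) ^ j ≤ 2 ^ (k - 2) := zpow_le_zpow_right₀ one_le_two h
  have h4 := norm_sub_norm_le x y
  rw [two_zpow_eq] at h1
  rw [dist_eq_norm]
  linarith

/-- The point x may be anywhere in the ball, not just in an annulus, so that the estimate also
serves for compact sets containing the origin. -/
theorem lt_dist_of_outer {j k : ℤ} (h : k + 2 ≤ j) {x y : EuclideanSpace ℝ (Fin n)}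
    (hx : x ∈ Metric.closedBall 0 ((2 : ℝ) ^ k)) (hy : y ∈ annulus n j) :
    (2 : ℝ) ^ (max k j - 2) < dist x y := by
  rw [max_eq_right (by omega)]
  have h1 := mem_closedBall_zero_iff.1 hx
  have h2 := (mem_annulus.1 hy).1
  have h3 : (2 : ℝ) ^ k ≤ 2 ^ (j - 2) := zpow_le_zpow_right₀ one_le_two (by omega)
  have h4 := norm_sub_norm_le y x
  rw [two_zpow_eq] at h2
  rw [dist_comm, dist_eq_norm]
  linarith

theorem volume_closedBall_two_zpow (x : EuclideanSpace ℝ (Fin n)) (k : ℤ) :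
    volume (Metric.closedBall x ((2 : ℝ) ^ k))
      = twoPow (k * n) * volume (Metric.ball (0 : EuclideanSpace ℝ (Fin n)) 1) := by
  rw [Measure.addHaar_closedBall _ _ (by positivity), finrank_euclideanSpace_fin,
    ENNReal.ofReal_pow (by positivity), ofReal_two_zpow, ← ENNReal.rpow_natCast, twoPow_rpow]

theorem volume_unitBall_ne_zero :
    volume (Metric.ball (0 : EuclideanSpace ℝ (Fin n)) 1) ≠ 0 :=
  (Metric.measure_ball_pos _ _ one_pos).ne'

theorem volume_unitBall_ne_top :
    volume (Metric.ball (0 : EuclideanSpace ℝ (Fin n)) 1) ≠ ∞ := measure_ball_lt_top.ne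

theorem ofReal_two_mul_two_zpow (k : ℤ) : ENNReal.ofReal (2 * (2 : ℝ) ^ k) = twoPow (k + 1) := by
  rw [← zpow_one_add₀ two_ne_zero, ofReal_two_zpow]
  congr 1
  push_cast
  ring

end Geometry

/-! ### Pointwise estimates for the commutator. -/

section Pointwise

variable {n : ℕ} {𝕜 : Type*} [RCLike 𝕜] {l : ℝ} {b f : EuclideanSpace ℝ (Fin n) → 𝕜}

theorem one_div_conjExponent_nonneg (hl : 1 < l) : 0 ≤ 1 / Real.conjExponent l := by
  have : 0 < l - 1 := sub_pos.2 hl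
  rw [Real.conjExponent]
  positivity

/-- Balls of radius at most ρ miss S; for larger ones the negative power of the volume is at most
its value at ρ. -/
theorem fracMaxComm_le_of_forall_lt_dist (hl : 1 < l) {S : Set (EuclideanSpace ℝ (Fin n))}
    (hS : MeasurableSet S) {x : EuclideanSpace ℝ (Fin n)} {ρ : ℝ} (h : ∀ y ∈ S, ρ < dist x y) :
    fracMaxComm l b (S.indicator f) x
      ≤ volume (Metric.closedBall x ρ) ^ (-(1 / Real.conjExponent l)) *
        ∫⁻ y in S, ‖b x - b y‖ₑ * ‖f y‖ₑ := by
  have hind : ∀ y, ‖b x - b y‖ₑ * ‖S.indicator f y‖ₑ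
      = S.indicator (fun y => ‖b x - b y‖ₑ * ‖f y‖ₑ) y := fun y => by
    by_cases hy : y ∈ S <;> simp [hy]
  refine iSup₂_le fun r _ => ?_
  simp_rw [hind]
  rcases le_or_gt r ρ with hr | hr
  · have : ∫⁻ y in Metric.closedBall x r, S.indicator (fun y => ‖b x - b y‖ₑ * ‖f y‖ₑ) y = 0 := by
      rw [setLIntegral_congr_fun (g := fun _ => 0) Metric.isClosed_closedBall.measurableSet]
      · simp
      · intro y hy
        refine indicator_of_notMem (fun hyS => ?_) _
        have := h y hyS
        rw [Metric.mem_closedBall, dist_comm] at hy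
        linarith
    rw [this, mul_zero]
    exact zero_le
  · gcongr ?_ * ?_
    · rw [ENNReal.rpow_neg, ENNReal.rpow_neg, ENNReal.inv_le_inv]
      exact ENNReal.rpow_le_rpow (measure_mono (Metric.closedBall_subset_closedBall hr.le))
        (one_div_conjExponent_nonneg hl)
    · rw [← lintegral_indicator hS]
      exact lintegral_mono' Measure.restrict_le_self le_rfl

/-- One admissible radius already bounds the supremum from below. This converts boundedness of the
operator into information on b. -/
theorem setLIntegral_le_fracMaxComm {S : Set (EuclideanSpace ℝ (Fin n))}
    (hS : MeasurableSet S) {x : EuclideanSpace ℝ (Fin n)} {r : ℝ} (hr : 0 < r)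
    (h : S ⊆ Metric.closedBall x r) :
    ∫⁻ y in S, ‖b x - b y‖ₑ * ‖f y‖ₑ
      ≤ volume (Metric.closedBall x r) ^ (1 / Real.conjExponent l) *
        fracMaxComm l b (S.indicator f) x := by
  have hind : ∀ y, ‖b x - b y‖ₑ * ‖S.indicator f y‖ₑ
      = S.indicator (fun y => ‖b x - b y‖ₑ * ‖f y‖ₑ) y := fun y => by
    by_cases hy : y ∈ S <;> simp [hy]
  have h1 : volume (Metric.closedBall x r) ^ (-(1 / Real.conjExponent l)) *
      ∫⁻ y in S, ‖b x - b y‖ₑ * ‖f y‖ₑ ≤ fracMaxComm l b (S.indicator f) x := by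
    refine le_trans (le_of_eq ?_) (le_iSup₂ (f := fun (r : ℝ) (_ : 0 < r) =>
      volume (Metric.closedBall x r) ^ (-(1 / Real.conjExponent l)) *
        ∫⁻ y in Metric.closedBall x r, ‖b x - b y‖ₑ * ‖S.indicator f y‖ₑ) r hr)
    simp_rw [hind]
    rw [setLIntegral_indicator hS, inter_eq_left.2 h]
  have h0 : volume (Metric.closedBall x r) ≠ 0 := (Metric.measure_closedBall_pos _ _ hr).ne'
  have ht : volume (Metric.closedBall x r) ≠ ∞ := measure_closedBall_lt_top.ne
  calc ∫⁻ y in S, ‖b x - b y‖ₑ * ‖f y‖ₑ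
      = volume (Metric.closedBall x r) ^ (1 / Real.conjExponent l) *
        (volume (Metric.closedBall x r) ^ (-(1 / Real.conjExponent l)) *
          ∫⁻ y in S, ‖b x - b y‖ₑ * ‖f y‖ₑ) := by
        rw [← mul_assoc, ← ENNReal.rpow_add _ _ h0 ht, add_neg_cancel, ENNReal.rpow_zero, one_mul]
    _ ≤ _ := by gcongr

theorem fracMaxComm_le_add_tsum (hb : AEStronglyMeasurable b volume)
    (hf : AEStronglyMeasurable f volume) {S : Set (EuclideanSpace ℝ (Fin n))}
    (hS : MeasurableSet S) {ι : Type*} [Countable ι] {U : ι → Set (EuclideanSpace ℝ (Fin n))}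
    (hU : ∀ i, MeasurableSet (U i)) (hcover : ∀ᵐ y, y ∈ S ∨ ∃ i, y ∈ U i)
    (x : EuclideanSpace ℝ (Fin n)) :
    fracMaxComm l b f x
      ≤ fracMaxComm l b (S.indicator f) x + ∑' i, fracMaxComm l b ((U i).indicator f) x := by
  have hmeas : ∀ {V : Set (EuclideanSpace ℝ (Fin n))}, MeasurableSet V →
      AEMeasurable fun y => ‖b x - b y‖ₑ * ‖V.indicator f y‖ₑ := fun hV =>
    (aestronglyMeasurable_const.sub hb).enorm.mul (hf.indicator hV).enorm
  refine iSup₂_le fun r hr => ?_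
  calc volume (Metric.closedBall x r) ^ (-(1 / Real.conjExponent l)) *
        ∫⁻ y in Metric.closedBall x r, ‖b x - b y‖ₑ * ‖f y‖ₑ
      ≤ volume (Metric.closedBall x r) ^ (-(1 / Real.conjExponent l)) *
        ∫⁻ y in Metric.closedBall x r, (‖b x - b y‖ₑ * ‖S.indicator f y‖ₑ +
          ∑' i, ‖b x - b y‖ₑ * ‖(U i).indicator f y‖ₑ) := by
        refine mul_le_mul_right (lintegral_mono_ae (ae_restrict_of_ae ?_)) _
        filter_upwards [hcover] with y hy
        rcases hy with hy | ⟨i, hy⟩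
        · refine le_trans (le_of_eq ?_) le_self_add
          rw [indicator_of_mem hy]
        · refine le_trans ?_ le_add_self
          refine le_trans (le_of_eq ?_)
            (ENNReal.le_tsum (f := fun i => ‖b x - b y‖ₑ * ‖(U i).indicator f y‖ₑ) i)
          rw [indicator_of_mem hy]
    _ = volume (Metric.closedBall x r) ^ (-(1 / Real.conjExponent l)) *
          (∫⁻ y in Metric.closedBall x r, ‖b x - b y‖ₑ * ‖S.indicator f y‖ₑ) +
        ∑' i, volume (Metric.closedBall x r) ^ (-(1 / Real.conjExponent l)) *
          ∫⁻ y in Metric.closedBall x r, ‖b x - b y‖ₑ * ‖(U i).indicator f y‖ₑ := by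
        rw [lintegral_add_left' (hmeas hS).restrict,
          lintegral_tsum fun i => (hmeas (hU i)).restrict, mul_add, ENNReal.tsum_mul_left]
    _ ≤ _ := by
        refine add_le_add ?_ (ENNReal.tsum_le_tsum fun i => ?_)
        · exact le_iSup₂ (f := fun (r : ℝ) (_ : 0 < r) =>
            volume (Metric.closedBall x r) ^ (-(1 / Real.conjExponent l)) *
              ∫⁻ y in Metric.closedBall x r, ‖b x - b y‖ₑ * ‖S.indicator f y‖ₑ) r hr
        · exact le_iSup₂ (f := fun (r : ℝ) (_ : 0 < r) =>
            volume (Metric.closedBall x r) ^ (-(1 / Real.conjExponent l)) *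
              ∫⁻ y in Metric.closedBall x r, ‖b x - b y‖ₑ * ‖(U i).indicator f y‖ₑ) r hr

/-- A ball of radius r about x only sees f on the ball of radius r + |x| about the origin. This
reduces measurability for locally mixed-integrable f to the globally integrable case. -/
theorem fracMaxComm_eq_iSup (l : ℝ) (b f : EuclideanSpace ℝ (Fin n) → 𝕜)
    (x : EuclideanSpace ℝ (Fin n)) :
    fracMaxComm l b f x =
      ⨆ N : ℕ, fracMaxComm l b ((Metric.closedBall 0 (N : ℝ)).indicator f) x := by
  refine le_antisymm (iSup₂_le fun r hr => ?_) (iSup_le fun N => ?_)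
  · obtain ⟨N, hN⟩ := exists_nat_ge (r + ‖x‖)
    refine le_trans (le_of_eq ?_) (le_iSup_of_le N (le_iSup₂ (f := fun (r : ℝ) (_ : 0 < r) =>
      volume (Metric.closedBall x r) ^ (-(1 / Real.conjExponent l)) *
        ∫⁻ y in Metric.closedBall x r,
          ‖b x - b y‖ₑ * ‖(Metric.closedBall 0 (N : ℝ)).indicator f y‖ₑ) r hr))
    congr 1
    refine setLIntegral_congr_fun Metric.isClosed_closedBall.measurableSet fun y hy => ?_
    have : y ∈ Metric.closedBall (0 : EuclideanSpace ℝ (Fin n)) (N : ℝ) := by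
      rw [mem_closedBall_zero_iff]
      rw [mem_closedBall_iff_norm] at hy
      have := norm_le_norm_add_norm_sub' y x
      linarith
    simp only [indicator_of_mem this]
  · refine iSup₂_mono fun r _ => ?_
    gcongr with y
    rw [enorm_indicator_eq_indicator_enorm]
    exact indicator_le_self _ _ y

/-- The mean of `b` over the dyadic ball of radius `2ᵏ`. -/
noncomputable def dyadicMean (b : EuclideanSpace ℝ (Fin n) → 𝕜) (k : ℤ) : 𝕜 :=
  ⨍ z in Metric.closedBall 0 ((2 : ℝ) ^ k), b z

/-- |B|(w - c_k) is the integral of w - b over B. With w = b(x), the right side is the commutator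
integral of χ_B. -/
theorem volume_mul_enorm_sub_dyadicMean_le (hb : LocallyIntegrable b volume) (w : 𝕜) (k : ℤ) :
    volume (Metric.closedBall (0 : EuclideanSpace ℝ (Fin n)) ((2 : ℝ) ^ k)) *
      ‖w - dyadicMean b k‖ₑ ≤ ∫⁻ y in Metric.closedBall 0 ((2 : ℝ) ^ k), ‖w - b y‖ₑ := by
  set B := Metric.closedBall (0 : EuclideanSpace ℝ (Fin n)) ((2 : ℝ) ^ k)
  have hB : volume B ≠ ∞ := measure_closedBall_lt_top.ne
  have hint : IntegrableOn b B := hb.integrableOn_isCompact (isCompact_closedBall _ _)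
  have h : ∫ y in B, (w - b y) = volume.real B • (w - dyadicMean b k) := by
    rw [integral_sub (integrableOn_const hB (C := w) enorm_ne_top) hint, setIntegral_const,
      smul_sub, dyadicMean, measure_smul_setAverage _ hB]
  calc volume B * ‖w - dyadicMean b k‖ₑ = ‖∫ y in B, (w - b y)‖ₑ := by
        rw [h, enorm_smul, Measure.real, Real.enorm_eq_ofReal ENNReal.toReal_nonneg,
          ENNReal.ofReal_toReal hB]
    _ ≤ _ := enorm_integral_le_lintegral_enorm _

end Pointwise

/-! ### Oscillation of b deduced from boundedness on mixed Lebesgue spaces. -/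

/-- The sum of the reciprocals of a family of exponents. -/
noncomputable def recipSum {n : ℕ} (q : Fin n → ℝ) : ℝ := ∑ i, 1 / q i

section Operator

variable {n : ℕ} {𝕜 : Type*} [RCLike 𝕜] {l : ℝ} {b : EuclideanSpace ℝ (Fin n) → 𝕜}
  {q q₁ q₂ : Fin n → ℝ}

theorem mixedNorm_dyadicBall_le (hq : ∀ i, 0 < q i) (k : ℤ) :
    mixedNorm q ((Metric.closedBall (0 : EuclideanSpace ℝ (Fin n)) ((2 : ℝ) ^ k)).indicator 1)
      ≤ twoPow ((k + 1) * recipSum q) := by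
  refine (mixedNorm_closedBall_le hq (by positivity)).trans_eq ?_
  rw [ofReal_two_mul_two_zpow, twoPow_rpow, recipSum]

theorem setLIntegral_dyadicBall_le (hq : ∀ i, 1 ≤ q i) {g : EuclideanSpace ℝ (Fin n) → ℝ≥0∞}
    (hg : AEMeasurable g) (k : ℤ) :
    ∫⁻ x in Metric.closedBall 0 ((2 : ℝ) ^ k), g x
      ≤ twoPow ((k + 1) * (n - recipSum q)) * mixedNorm q g := by
  refine (setLIntegral_closedBall_le hq (by positivity) hg).trans_eq ?_
  rw [ofReal_two_mul_two_zpow, twoPow_rpow, recipSum]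

theorem memMixedLp_indicator {f : EuclideanSpace ℝ (Fin n) → 𝕜}
    (hf : AEStronglyMeasurable f volume) {S : Set (EuclideanSpace ℝ (Fin n))}
    (hS : MeasurableSet S) (hfin : mixedNorm q (S.indicator fun x => ‖f x‖ₑ) < ∞) :
    MemMixedLp q (S.indicator f) := by
  refine ⟨hf.indicator hS, ?_⟩
  simp_rw [enorm_indicator_eq_indicator_enorm]
  exact hfin

/-- Boundedness of the commutator from mixed Lebesgue spaces forces the mixed-norm oscillation of
`b` over dyadic balls to be of the size of the norm of the characteristic function. -/
theorem exists_mixedNorm_osc_le (hb : LocallyIntegrable b volume) (hq₁ : ∀ i, 0 < q₁ i)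
    (hq₂ : ∀ i, 0 < q₂ i)
    (hs : n * (1 / Real.conjExponent l) = n - recipSum q₁ + recipSum q₂)
    (hbdd : BoundedMixedLp q₁ q₂ (fracMaxComm l b)) :
    ∃ C : ℝ≥0∞, C ≠ ∞ ∧ ∀ k : ℤ, mixedNorm q₂ ((Metric.closedBall 0 ((2 : ℝ) ^ k)).indicator
      fun x => ‖b x - dyadicMean b k‖ₑ) ≤ C * twoPow (k * recipSum q₂) := by
  obtain ⟨C₀, hC₀⟩ := hbdd
  set β := 1 / Real.conjExponent l with hβ
  set v := volume (Metric.ball (0 : EuclideanSpace ℝ (Fin n)) 1) with hv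
  have hv0 : v ≠ 0 := volume_unitBall_ne_zero
  have hvt : v ≠ ∞ := volume_unitBall_ne_top
  have hvβ : v⁻¹ * v ^ β ≠ ∞ := ENNReal.mul_ne_top (ENNReal.inv_ne_top.2 hv0) <| by
    simp [ENNReal.rpow_eq_top_iff, hv0, hvt]
  refine ⟨v⁻¹ * v ^ β * C₀ * twoPow (n * β + recipSum q₁), ENNReal.mul_ne_top
    (ENNReal.mul_ne_top hvβ ENNReal.coe_ne_top) (twoPow_ne_top _), fun k => ?_⟩
  set B := Metric.closedBall (0 : EuclideanSpace ℝ (Fin n)) ((2 : ℝ) ^ k) with hB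
  have hBm : MeasurableSet B := Metric.isClosed_closedBall.measurableSet
  have hone : (B.indicator fun x => ‖(1 : 𝕜)‖ₑ) = B.indicator 1 := by
    simp only [enorm_one]; rfl
  have hnorm : mixedNorm q₁ (B.indicator fun x => ‖(1 : 𝕜)‖ₑ)
      ≤ twoPow ((k + 1) * recipSum q₁) := by
    rw [hone]
    exact mixedNorm_dyadicBall_le hq₁ k
  have hmem := memMixedLp_indicator (q := q₁) (f := fun _ : EuclideanSpace ℝ (Fin n) => (1 : 𝕜))
    aestronglyMeasurable_const hBm (hnorm.trans_lt (twoPow_ne_top _).lt_top)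
  have hT := (hC₀ _ hmem).2
  simp_rw [enorm_indicator_eq_indicator_enorm] at hT
  have hpt : ∀ x ∈ B, ‖b x - dyadicMean b k‖ₑ
      ≤ twoPow (-(k * n) + (k + 1) * (n * β)) * (v⁻¹ * v ^ β) *
        fracMaxComm l b (B.indicator fun _ => 1) x := fun x hx => by
    have h1 := volume_mul_enorm_sub_dyadicMean_le hb (b x) k
    -- For x in B, doubling the radius makes the ball about x contain B.
    have hsub : B ⊆ Metric.closedBall x ((2 : ℝ) ^ (k + 1)) := by
      refine Metric.closedBall_subset_closedBall' ?_
      rw [Metric.mem_closedBall, dist_comm] at hx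
      rw [zpow_add_one₀ two_ne_zero]
      linarith
    have h2 := setLIntegral_le_fracMaxComm (l := l) (b := b) (f := fun _ => (1 : 𝕜)) hBm
      (by positivity) hsub
    simp only [enorm_one, mul_one] at h2
    have h3 := h1.trans h2
    rw [volume_closedBall_two_zpow, volume_closedBall_two_zpow, ← hv, ← hβ,
      ENNReal.mul_rpow_of_ne_top (twoPow_ne_top _) hvt, twoPow_rpow] at h3
    calc ‖b x - dyadicMean b k‖ₑ
        = twoPow (-(k * n)) * v⁻¹ * (twoPow (k * n) * v * ‖b x - dyadicMean b k‖ₑ) := by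
          rw [show twoPow (-(k * n)) * v⁻¹ * (twoPow (k * n) * v * ‖b x - dyadicMean b k‖ₑ)
            = (twoPow (-(k * n)) * twoPow (k * n)) * (v⁻¹ * v) * ‖b x - dyadicMean b k‖ₑ by ring,
            twoPow_neg_mul_cancel, ENNReal.inv_mul_cancel hv0 hvt, one_mul, one_mul]
      _ ≤ twoPow (-(k * n)) * v⁻¹ * (twoPow (((k + 1 : ℤ) : ℝ) * n * β) * v ^ β *
            fracMaxComm l b (B.indicator fun _ => 1) x) := by gcongr
      _ = _ := by
          rw [twoPow_add]
          push_cast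
          ring_nf
  calc mixedNorm q₂ (B.indicator fun x => ‖b x - dyadicMean b k‖ₑ)
      ≤ mixedNorm q₂ fun x => twoPow (-(k * n) + (k + 1) * (n * β)) * (v⁻¹ * v ^ β) *
          fracMaxComm l b (B.indicator fun _ => 1) x := by
        refine mixedNorm_mono (fun i => (hq₂ i).le) fun x => ?_
        by_cases hx : x ∈ B
        · rw [indicator_of_mem hx]
          exact hpt x hx
        · rw [indicator_of_notMem hx]
          exact zero_le
    _ ≤ twoPow (-(k * n) + (k + 1) * (n * β)) * (v⁻¹ * v ^ β) *
          (C₀ * twoPow ((k + 1) * recipSum q₁)) := by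
        rw [mixedNorm_const_mul hq₂ _ (ENNReal.mul_ne_top (twoPow_ne_top _) hvβ)]
        gcongr
        exact hT.trans (by gcongr)
    _ = v⁻¹ * v ^ β * C₀ *
          (twoPow (-(k * n) + (k + 1) * (n * β)) * twoPow ((k + 1) * recipSum q₁)) := by ring
    _ = _ := by
        rw [mul_assoc _ (twoPow _), ← twoPow_add, ← twoPow_add]
        congr 2
        -- The scaling relation turns the coefficient -n + n/l' + s₁ of k into s₂.
        linear_combination (k : ℝ) * hs

/-- The dual oscillation bound, obtained by averaging the commutator over a dyadic ball. -/
theorem exists_setLIntegral_osc_le (hb : LocallyIntegrable b volume) (hq₂ : ∀ i, 1 ≤ q₂ i)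
    (hs : n * (1 / Real.conjExponent l) = n - recipSum q₁ + recipSum q₂)
    (hbdd : BoundedMixedLp q₁ q₂ (fracMaxComm l b)) :
    ∃ C : ℝ≥0∞, C ≠ ∞ ∧ ∀ (f : EuclideanSpace ℝ (Fin n) → 𝕜), AEStronglyMeasurable f volume →
      ∀ j : ℤ, mixedNorm q₁ ((annulus n j).indicator fun x => ‖f x‖ₑ) < ∞ →
        ∫⁻ y in annulus n j, ‖b y - dyadicMean b j‖ₑ * ‖f y‖ₑ
          ≤ C * (twoPow (j * (n - recipSum q₁)) *
            mixedNorm q₁ ((annulus n j).indicator fun x => ‖f x‖ₑ)) := by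
  obtain ⟨C₀, hC₀⟩ := hbdd
  set β := 1 / Real.conjExponent l with hβ
  set v := volume (Metric.ball (0 : EuclideanSpace ℝ (Fin n)) 1) with hv
  have hv0 : v ≠ 0 := volume_unitBall_ne_zero
  have hvt : v ≠ ∞ := volume_unitBall_ne_top
  have hvβ' : v ^ β ≠ ∞ := by simp [ENNReal.rpow_eq_top_iff, hv0, hvt]
  have hvβ : v⁻¹ * v ^ β ≠ ∞ := ENNReal.mul_ne_top (ENNReal.inv_ne_top.2 hv0) hvβ'
  refine ⟨v⁻¹ * v ^ β * C₀ * twoPow (n * β + n - recipSum q₂), ENNReal.mul_ne_top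
    (ENNReal.mul_ne_top hvβ ENNReal.coe_ne_top) (twoPow_ne_top _), fun f hf j hfin => ?_⟩
  set A := annulus n j with hA
  set B := Metric.closedBall (0 : EuclideanSpace ℝ (Fin n)) ((2 : ℝ) ^ j) with hB
  set N := mixedNorm q₁ (A.indicator fun x => ‖f x‖ₑ) with hN
  set I := ∫⁻ y in A, ‖b y - dyadicMean b j‖ₑ * ‖f y‖ₑ with hI
  have hAm : MeasurableSet A := measurableSet_annulus j
  have hbm := hb.aestronglyMeasurable
  have hmem := memMixedLp_indicator hf hAm hfin
  obtain ⟨⟨hTm, _⟩, hT⟩ := hC₀ _ hmem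
  simp_rw [enorm_indicator_eq_indicator_enorm] at hT
  have key : twoPow (j * n) * v * I
      ≤ twoPow ((j + 1) * (n * β)) * v ^ β *
        (twoPow ((j + 1) * (n - recipSum q₂)) * (C₀ * N)) := by
    calc twoPow (j * n) * v * I
        = ∫⁻ y in A, volume B * ‖b y - dyadicMean b j‖ₑ * ‖f y‖ₑ := by
          rw [volume_closedBall_two_zpow, ← hv, hI, ← lintegral_const_mul' _ _
            (ENNReal.mul_ne_top (twoPow_ne_top _) hvt)]
          simp_rw [mul_assoc]
      -- The oscillation at y is replaced by an average of |b(y)-b(x)| over x in B; after Tonelli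
      -- the inner integral is a commutator at x.
      _ ≤ ∫⁻ y in A, ∫⁻ x in B, ‖b y - b x‖ₑ * ‖f y‖ₑ := by
          refine lintegral_mono fun y => ?_
          simp only
          rw [lintegral_mul_const' _ _ enorm_ne_top]
          gcongr
          exact volume_mul_enorm_sub_dyadicMean_le hb (b y) j
      _ = ∫⁻ x in B, ∫⁻ y in A, ‖b y - b x‖ₑ * ‖f y‖ₑ := by
          refine lintegral_lintegral_swap ?_
          exact ((hbm.restrict.comp_fst.sub hbm.restrict.comp_snd).enorm).mul
            hf.restrict.comp_fst.enorm
      _ ≤ ∫⁻ x in B, twoPow ((j + 1) * (n * β)) * v ^ β * fracMaxComm l b (A.indicator f) x := by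
          refine setLIntegral_mono' Metric.isClosed_closedBall.measurableSet fun x hx => ?_
          have hsub : A ⊆ Metric.closedBall x ((2 : ℝ) ^ (j + 1)) := by
            refine (annulus_subset j).trans (Metric.closedBall_subset_closedBall' ?_)
            rw [Metric.mem_closedBall, dist_comm] at hx
            rw [zpow_add_one₀ two_ne_zero]
            linarith
          have h2 := setLIntegral_le_fracMaxComm (l := l) (b := b) (f := f) hAm
            (by positivity) hsub
          rw [volume_closedBall_two_zpow, ← hv, ← hβ,
            ENNReal.mul_rpow_of_ne_top (twoPow_ne_top _) hvt, twoPow_rpow] at h2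
          simp_rw [← edist_eq_enorm_sub] at h2 ⊢
          simp_rw [edist_comm (b x)] at h2
          refine h2.trans_eq ?_
          push_cast
          ring_nf
      _ = twoPow ((j + 1) * (n * β)) * v ^ β * ∫⁻ x in B, fracMaxComm l b (A.indicator f) x :=
          lintegral_const_mul' _ _ (ENNReal.mul_ne_top (twoPow_ne_top _) hvβ')
      _ ≤ _ := by
          gcongr
          exact (setLIntegral_dyadicBall_le hq₂ hTm.aemeasurable j).trans (by gcongr)
  calc I = twoPow (-(j * n)) * v⁻¹ * (twoPow (j * n) * v * I) := by
        rw [show twoPow (-(j * n)) * v⁻¹ * (twoPow (j * n) * v * I)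
          = (twoPow (-(j * n)) * twoPow (j * n)) * (v⁻¹ * v) * I by ring,
          twoPow_neg_mul_cancel, ENNReal.inv_mul_cancel hv0 hvt, one_mul, one_mul]
    _ ≤ twoPow (-(j * n)) * v⁻¹ * (twoPow ((j + 1) * (n * β)) * v ^ β *
        (twoPow ((j + 1) * (n - recipSum q₂)) * (C₀ * N))) := by gcongr
    _ = v⁻¹ * v ^ β * C₀ * (twoPow (-(j * n)) * twoPow ((j + 1) * (n * β)) *
        twoPow ((j + 1) * (n - recipSum q₂))) * N := by ring
    _ = v⁻¹ * v ^ β * C₀ * (twoPow (n * β + n - recipSum q₂) * twoPow (j * (n - recipSum q₁))) *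
        N := by
        simp_rw [← twoPow_add]
        congr 3
        linear_combination (j : ℝ) * hs
    _ = _ := by ring

theorem setLIntegral_annulus_le (hq : ∀ i, 1 ≤ q i) {f : EuclideanSpace ℝ (Fin n) → 𝕜}
    (hf : AEStronglyMeasurable f volume) (j : ℤ) :
    ∫⁻ y in annulus n j, ‖f y‖ₑ ≤ twoPow (n - recipSum q) * (twoPow (j * (n - recipSum q)) *
      mixedNorm q ((annulus n j).indicator fun x => ‖f x‖ₑ)) := by
  have h := setLIntegral_dyadicBall_le hq (hf.enorm.indicator (measurableSet_annulus j)) j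
  rw [setLIntegral_indicator (measurableSet_annulus j), inter_eq_left.2 (annulus_subset j)] at h
  refine h.trans_eq ?_
  rw [← mul_assoc, ← twoPow_add]
  congr 2
  ring

/-- Telescoping over the |j-k| steps between the two indices. -/
theorem enorm_sub_le_of_succ {c : ℤ → 𝕜} {D : ℝ≥0∞} (h : ∀ k, ‖c (k + 1) - c k‖ₑ ≤ D) (k j : ℤ) :
    ‖c k - c j‖ₑ ≤ D * ENNReal.ofReal |(j : ℝ) - k| := by
  have hnat : ∀ (k : ℤ) (m : ℕ), ‖c (k + m) - c k‖ₑ ≤ D * m := fun k m => by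
    induction m with
    | zero => simp
    | succ m ih =>
      calc ‖c (k + (m + 1 : ℕ)) - c k‖ₑ
          = ‖(c (k + m + 1) - c (k + m)) + (c (k + m) - c k)‖ₑ := by
            rw [sub_add_sub_cancel]; push_cast; rw [add_assoc]
        _ ≤ D + D * m := (enorm_add_le _ _).trans (add_le_add (h _) ih)
        _ = _ := by push_cast; ring
  rcases le_total k j with hkj | hkj
  · obtain ⟨m, rfl⟩ := Int.le.dest hkj
    rw [← edist_eq_enorm_sub, edist_comm, edist_eq_enorm_sub]
    simpa using hnat k m
  · obtain ⟨m, rfl⟩ := Int.le.dest hkj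
    simpa using hnat j m

/-- The oscillation about c_{k+1} on B_{k+1}, integrated over the smaller B_k, bounds
|B_k||c_{k+1}-c_k|; Hölder turns the mixed-norm bound into an integral of order 2^{kn}, so
consecutive means differ by a constant. -/
theorem exists_dyadicMean_sub_le (hb : LocallyIntegrable b volume) (hq₂ : ∀ i, 1 ≤ q₂ i)
    {C : ℝ≥0∞} (hC : C ≠ ∞)
    (hosc : ∀ k : ℤ, mixedNorm q₂ ((Metric.closedBall 0 ((2 : ℝ) ^ k)).indicator
      fun x => ‖b x - dyadicMean b k‖ₑ) ≤ C * twoPow (k * recipSum q₂)) :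
    ∃ D : ℝ≥0∞, D ≠ ∞ ∧ ∀ k j : ℤ,
      ‖dyadicMean b k - dyadicMean b j‖ₑ ≤ D * ENNReal.ofReal |(j : ℝ) - k| := by
  set v := volume (Metric.ball (0 : EuclideanSpace ℝ (Fin n)) 1) with hv
  have hv0 : v ≠ 0 := volume_unitBall_ne_zero
  have hvt : v ≠ ∞ := volume_unitBall_ne_top
  refine ⟨v⁻¹ * C * twoPow (2 * n - recipSum q₂), ENNReal.mul_ne_top
    (ENNReal.mul_ne_top (ENNReal.inv_ne_top.2 hv0) hC) (twoPow_ne_top _),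
    enorm_sub_le_of_succ fun k => ?_⟩
  set X := ‖dyadicMean b (k + 1) - dyadicMean b k‖ₑ
  have hsub : Metric.closedBall (0 : EuclideanSpace ℝ (Fin n)) ((2 : ℝ) ^ k) ⊆
      Metric.closedBall 0 ((2 : ℝ) ^ (k + 1)) :=
    Metric.closedBall_subset_closedBall (zpow_le_zpow_right₀ one_le_two (by omega))
  have hmeas : AEMeasurable ((Metric.closedBall (0 : EuclideanSpace ℝ (Fin n))
      ((2 : ℝ) ^ (k + 1))).indicator fun x => ‖b x - dyadicMean b (k + 1)‖ₑ) :=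
    (hb.aestronglyMeasurable.sub aestronglyMeasurable_const).enorm.indicator
      Metric.isClosed_closedBall.measurableSet
  have key : twoPow (k * n) * v * X ≤ twoPow ((k + 1 + 1) * (n - recipSum q₂)) *
      (C * twoPow ((k + 1) * recipSum q₂)) := by
    rw [← volume_closedBall_two_zpow 0]
    refine (volume_mul_enorm_sub_dyadicMean_le hb _ k).trans ?_
    calc ∫⁻ y in Metric.closedBall 0 ((2 : ℝ) ^ k), ‖dyadicMean b (k + 1) - b y‖ₑ
        ≤ ∫⁻ y in Metric.closedBall 0 ((2 : ℝ) ^ (k + 1)), ‖dyadicMean b (k + 1) - b y‖ₑ :=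
          lintegral_mono_set hsub
      _ = ∫⁻ y in Metric.closedBall 0 ((2 : ℝ) ^ (k + 1)), (Metric.closedBall 0
            ((2 : ℝ) ^ (k + 1))).indicator (fun x => ‖b x - dyadicMean b (k + 1)‖ₑ) y := by
          refine setLIntegral_congr_fun Metric.isClosed_closedBall.measurableSet fun y hy => ?_
          simp only [indicator_of_mem hy, ← edist_eq_enorm_sub, edist_comm]
      _ ≤ _ := by
          refine (setLIntegral_dyadicBall_le hq₂ hmeas (k + 1)).trans ?_
          have := hosc (k + 1)
          push_cast at this ⊢
          gcongr
  calc X = twoPow (-(k * n)) * v⁻¹ * (twoPow (k * n) * v * X) := by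
        rw [show twoPow (-(k * n)) * v⁻¹ * (twoPow (k * n) * v * X)
          = (twoPow (-(k * n)) * twoPow (k * n)) * (v⁻¹ * v) * X by ring,
          twoPow_neg_mul_cancel, ENNReal.inv_mul_cancel hv0 hvt, one_mul, one_mul]
    _ ≤ twoPow (-(k * n)) * v⁻¹ * (twoPow ((k + 1 + 1) * (n - recipSum q₂)) *
          (C * twoPow ((k + 1) * recipSum q₂))) := by gcongr
    _ = v⁻¹ * C * (twoPow (-(k * n)) * twoPow ((k + 1 + 1) * (n - recipSum q₂)) *
          twoPow ((k + 1) * recipSum q₂)) := by ring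
    _ = _ := by
        simp_rw [← twoPow_add]
        congr 2
        ring

/-! ### Interaction between distant annuli and its decay. -/

/-- The decay weight of the interaction between the annuli `k` and `j`; here `τ = n / l'` and
`σ` is `n` minus the sum of the reciprocals of the source exponents. -/
noncomputable def farWeight (τ σ : ℝ) (k j : ℤ) : ℝ≥0∞ :=
  twoPow (-(max k j : ℤ) * τ + j * σ) * ENNReal.ofReal (1 + |(j : ℝ) - k|)

/-- b(x)-b(y) goes through c_k and c_j. The only dependence on x left is the factor |b(x)-c_k| + 1,
common to all j, so the sum over j can be taken before any norm in x. -/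
theorem exists_fracMaxComm_far_le (hl : 1 < l) (hb : LocallyIntegrable b volume)
    (hq₁ : ∀ i, 1 ≤ q₁ i) (hq₂ : ∀ i, 1 ≤ q₂ i)
    (hs : n * (1 / Real.conjExponent l) = n - recipSum q₁ + recipSum q₂)
    (hbdd : BoundedMixedLp q₁ q₂ (fracMaxComm l b)) {D : ℝ≥0∞} (hD : D ≠ ∞)
    (hmean : ∀ k j : ℤ,
      ‖dyadicMean b k - dyadicMean b j‖ₑ ≤ D * ENNReal.ofReal |(j : ℝ) - k|) :
    ∃ C : ℝ≥0∞, C ≠ ∞ ∧ ∀ (f : EuclideanSpace ℝ (Fin n) → 𝕜), AEStronglyMeasurable f volume →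
      ∀ k j : ℤ, mixedNorm q₁ ((annulus n j).indicator fun x => ‖f x‖ₑ) < ∞ →
        ∀ x, (∀ y ∈ annulus n j, (2 : ℝ) ^ (max k j - 2) < dist x y) →
          fracMaxComm l b ((annulus n j).indicator f) x ≤
            C * (farWeight (n * (1 / Real.conjExponent l)) (n - recipSum q₁) k j *
              mixedNorm q₁ ((annulus n j).indicator fun x => ‖f x‖ₑ)) *
                (‖b x - dyadicMean b k‖ₑ + 1) := by
  obtain ⟨C₂, hC₂, hdual⟩ := exists_setLIntegral_osc_le hb hq₂ hs hbdd
  set β := 1 / Real.conjExponent l with hβ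
  set v := volume (Metric.ball (0 : EuclideanSpace ℝ (Fin n)) 1) with hv
  have hv0 : v ≠ 0 := volume_unitBall_ne_zero
  have hvt : v ≠ ∞ := volume_unitBall_ne_top
  have hvβ : v ^ (-β) ≠ ∞ := by simp [ENNReal.rpow_eq_top_iff, hv0, hvt]
  set C₁ := twoPow (n - recipSum q₁) with hC₁
  refine ⟨v ^ (-β) * twoPow (2 * (n * β)) * (C₁ * (1 + D) + C₂), ENNReal.mul_ne_top
    (ENNReal.mul_ne_top hvβ (twoPow_ne_top _)) (ENNReal.add_ne_top.2 ⟨ENNReal.mul_ne_top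
    (twoPow_ne_top _) (ENNReal.add_ne_top.2 ⟨ENNReal.one_ne_top, hD⟩), hC₂⟩),
    fun f hf k j hfin x hx => ?_⟩
  set A := annulus n j with hA
  set N := mixedNorm q₁ (A.indicator fun x => ‖f x‖ₑ) with hN
  set Q := twoPow (j * (n - recipSum q₁)) * N with hQ
  set X := ‖b x - dyadicMean b k‖ₑ with hX
  set t := ENNReal.ofReal |(j : ℝ) - k| with ht
  have ht1 : ENNReal.ofReal (1 + |(j : ℝ) - k|) = 1 + t := by
    rw [ENNReal.ofReal_add zero_le_one (abs_nonneg _), ENNReal.ofReal_one]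
  have hAm : MeasurableSet A := measurableSet_annulus j
  have hint : ∫⁻ y in A, ‖b x - b y‖ₑ * ‖f y‖ₑ
      ≤ (C₁ * (1 + D) + C₂) * ((1 + t) * Q) * (X + 1) := by
    calc ∫⁻ y in A, ‖b x - b y‖ₑ * ‖f y‖ₑ
        ≤ ∫⁻ y in A, ((X + D * t) * ‖f y‖ₑ + ‖b y - dyadicMean b j‖ₑ * ‖f y‖ₑ) := by
          refine lintegral_mono fun y => ?_
          simp only
          rw [← add_mul]
          gcongr
          simp_rw [hX, ← edist_eq_enorm_sub]
          refine (edist_triangle4 (b x) (dyadicMean b k) (dyadicMean b j) (b y)).trans ?_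
          rw [edist_comm (dyadicMean b j) (b y)]
          gcongr
          rw [edist_eq_enorm_sub]
          exact hmean k j
      _ = (X + D * t) * (∫⁻ y in A, ‖f y‖ₑ) + ∫⁻ y in A, ‖b y - dyadicMean b j‖ₑ * ‖f y‖ₑ := by
          rw [lintegral_add_left' (hf.enorm.restrict.const_mul _), lintegral_const_mul' _ _
            (ENNReal.add_ne_top.2 ⟨enorm_ne_top, ENNReal.mul_ne_top hD ENNReal.ofReal_ne_top⟩)]
      _ ≤ (X + D * t) * (C₁ * Q) + C₂ * Q :=
          add_le_add (mul_le_mul_right (setLIntegral_annulus_le hq₁ hf j) _) (hdual f hf j hfin)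
      -- The added terms are those missing from the expansion of the product form.
      _ ≤ (X + D * t) * (C₁ * Q) + C₂ * Q + (C₁ * Q * (1 + X * t + t + D + D * X + D * X * t) +
            C₂ * Q * (X + t + X * t)) := le_self_add
      _ = _ := by ring
  calc fracMaxComm l b (A.indicator f) x
      ≤ volume (Metric.closedBall x ((2 : ℝ) ^ (max k j - 2))) ^ (-β) *
          ∫⁻ y in A, ‖b x - b y‖ₑ * ‖f y‖ₑ := fracMaxComm_le_of_forall_lt_dist hl hAm hx
    _ ≤ (v ^ (-β) * twoPow (2 * (n * β)) * twoPow (-(max k j : ℤ) * (n * β))) *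
          ((C₁ * (1 + D) + C₂) * ((1 + t) * Q) * (X + 1)) := by
        gcongr
        rw [volume_closedBall_two_zpow, ← hv, ENNReal.mul_rpow_of_ne_top (twoPow_ne_top _) hvt,
          twoPow_rpow, mul_assoc (v ^ _), ← twoPow_add, mul_comm (twoPow _)]
        refine le_of_eq ?_
        congr 2
        push_cast
        ring
    _ = _ := by
        rw [farWeight, ht1, hQ, twoPow_add]
        ring

end Operator

/-- Since τ = σ + s, the exponent before the linear factor is jα - (j-k)(α+s) for j ≥ k and jα -
(k-j)(σ-α) for j ≤ k. Each gap supplies 3e|j-k| beyond the Morrey factor: one e absorbs the linear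
factor, two remain. -/
theorem exists_farWeight_le {τ σ s α lam e : ℝ} (hτ : τ = σ + s) (he : 0 < e)
    (h1 : 3 * e ≤ α + s - lam) (h2 : 3 * e ≤ σ - α + lam) :
    ∃ C : ℝ≥0∞, C ≠ ∞ ∧ ∀ k j : ℤ, twoPow (k * α + k * s) * farWeight τ σ k j
      ≤ C * (twoPow (-(2 * e * |(j : ℝ) - k|)) * (twoPow (-(((j : ℝ) - k) * lam)) *
        twoPow (j * α))) := by
  obtain ⟨C, hC, hlin⟩ := exists_one_add_le_twoPow he
  refine ⟨C, hC, fun k j => ?_⟩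
  calc twoPow (k * α + k * s) * farWeight τ σ k j
      ≤ twoPow (k * α + k * s) * (twoPow (-(max k j : ℤ) * τ + j * σ) *
          (C * twoPow (e * |(j : ℝ) - k|))) := by
        rw [farWeight]
        gcongr
        exact hlin _ (abs_nonneg _)
    _ = C * twoPow (k * α + k * s + (-(max k j : ℤ) * τ + j * σ) + e * |(j : ℝ) - k|) := by
        rw [twoPow_add _ (e * _), twoPow_add (k * α + k * s)]
        ring
    _ ≤ _ := by
        rw [← twoPow_add, ← twoPow_add]
        refine mul_le_mul_right (twoPow_mono ?_) _
        rcases le_total k j with hkj | hkj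
        · have hm : (0 : ℝ) ≤ (j : ℝ) - k := sub_nonneg.2 (by exact_mod_cast hkj)
          rw [max_eq_right hkj, abs_of_nonneg hm, hτ]
          nlinarith [mul_le_mul_of_nonneg_left h1 hm]
        · have hm : (0 : ℝ) ≤ (k : ℝ) - j := sub_nonneg.2 (by exact_mod_cast hkj)
          rw [max_eq_left hkj, abs_of_nonpos (by linarith), hτ]
          nlinarith [mul_le_mul_of_nonneg_left h2 hm]

theorem exists_tsum_farWeight_le {τ σ s α lam e : ℝ} (hτ : τ = σ + s) (he : 0 < e)
    (h1 : 3 * e ≤ α + s - lam) (h2 : 3 * e ≤ σ - α + lam) :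
    ∃ C : ℝ≥0∞, C ≠ ∞ ∧ ∀ (N : ℤ → ℝ≥0∞) (k : ℤ),
      twoPow (k * α + k * s) * ∑' j, farWeight τ σ k j * N j
        ≤ C * ⨆ m : ℤ, twoPow (-(e * |(m : ℝ)|) - m * lam) *
          (twoPow ((k + m : ℤ) * α) * N (k + m)) := by
  obtain ⟨C, hC, hw⟩ := exists_farWeight_le hτ he h1 h2
  refine ⟨C * ∑' m : ℤ, twoPow (-(e * |(m : ℝ)|)),
    ENNReal.mul_ne_top hC (tsum_twoPow_neg_abs_ne_top he), fun N k => ?_⟩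
  calc twoPow (k * α + k * s) * ∑' j, farWeight τ σ k j * N j
      = ∑' j, twoPow (k * α + k * s) * farWeight τ σ k j * N j := by
        rw [← ENNReal.tsum_mul_left]
        simp_rw [mul_assoc]
    _ ≤ ∑' j : ℤ, C * (twoPow (-(2 * e * |(j : ℝ) - k|)) * (twoPow (-(((j : ℝ) - k) * lam)) *
          twoPow (j * α))) * N j := ENNReal.tsum_le_tsum fun j => mul_le_mul_left (hw k j) _
    _ = ∑' m : ℤ, C * (twoPow (-(2 * e * |(m : ℝ)|)) * (twoPow (-(m * lam)) *
          (twoPow ((k + m : ℤ) * α) * N (k + m)))) := by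
        rw [← (Equiv.addLeft k).tsum_eq]
        refine tsum_congr fun m => ?_
        have : (((Equiv.addLeft k) m : ℤ) : ℝ) - k = m := by simp
        rw [this, Equiv.coe_addLeft]
        ring
    _ ≤ C * ((∑' m : ℤ, twoPow (-(e * |(m : ℝ)|))) * ⨆ m : ℤ, twoPow (-(e * |(m : ℝ)|)) *
          (twoPow (-(m * lam)) * (twoPow ((k + m : ℤ) * α) * N (k + m)))) := by
        rw [ENNReal.tsum_mul_left]
        gcongr
        exact tsum_mul_le_mul_iSup _
    _ = _ := by
        rw [mul_assoc]
        simp_rw [sub_eq_add_neg, twoPow_add, mul_assoc]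

/-! ### Assembly: near and far parts, then the Herz-Morrey bound. -/

section Operator

variable {n : ℕ} {𝕜 : Type*} [RCLike 𝕜] {l : ℝ} {b f : EuclideanSpace ℝ (Fin n) → 𝕜}
  {q q₁ q₂ : Fin n → ℝ}

theorem aestronglyMeasurable_fracMaxComm (hbdd : BoundedMixedLp q₁ q₂ (fracMaxComm l b))
    (hf : MemMixedLpLoc q₁ f) : AEStronglyMeasurable (fracMaxComm l b f) volume := by
  obtain ⟨C₀, hC₀⟩ := hbdd
  have : fracMaxComm l b f = fun x =>
      ⨆ N : ℕ, fracMaxComm l b ((Metric.closedBall 0 (N : ℝ)).indicator f) x :=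
    funext (fracMaxComm_eq_iSup l b f)
  rw [this]
  refine (AEMeasurable.iSup fun N => ?_).aestronglyMeasurable
  exact (hC₀ _ (memMixedLp_indicator hf.1 Metric.isClosed_closedBall.measurableSet
    (hf.2 _ (isCompact_closedBall _ _)))).1.1.aemeasurable

theorem MemMixedLpLoc.annulus_lt_top (hq : ∀ i, 0 ≤ q i) (hf : MemMixedLpLoc q f) (k : ℤ) :
    mixedNorm q ((annulus n k).indicator fun x => ‖f x‖ₑ) < ∞ :=
  (mixedNorm_mono hq (indicator_le_indicator_of_subset (annulus_subset k)
    fun _ => zero_le)).trans_lt (hf.2 _ (isCompact_closedBall _ _))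

/-- The commutator on a set `U ⊆ B_k` is controlled by a near part, supported in `S`, and
the annuli `A_j`, `j ∈ J`, which are far from `U`. -/
theorem exists_mixedNorm_fracMaxComm_le (hl : 1 < l) (hb : LocallyIntegrable b volume)
    (hq₁ : ∀ i, 1 ≤ q₁ i) (hq₂ : ∀ i, 1 ≤ q₂ i)
    (hs : n * (1 / Real.conjExponent l) = n - recipSum q₁ + recipSum q₂)
    (hbdd : BoundedMixedLp q₁ q₂ (fracMaxComm l b)) :
    ∃ C : ℝ≥0∞, C ≠ ∞ ∧ ∀ f : EuclideanSpace ℝ (Fin n) → 𝕜, MemMixedLpLoc q₁ f →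
      ∀ k : ℤ, ∀ H : ℝ≥0∞, H ≠ ∞ →
      ∑' j, farWeight (n * (1 / Real.conjExponent l)) (n - recipSum q₁) k j *
        mixedNorm q₁ ((annulus n j).indicator fun x => ‖f x‖ₑ) ≤ H →
      ∀ (S U : Set (EuclideanSpace ℝ (Fin n))) (J : Set ℤ), MeasurableSet S →
        U ⊆ Metric.closedBall 0 ((2 : ℝ) ^ k) →
        (∀ᵐ y, y ∈ S ∨ ∃ j : J, y ∈ annulus n j) →
        (∀ j ∈ J, ∀ x ∈ U, ∀ y ∈ annulus n j, (2 : ℝ) ^ (max k j - 2) < dist x y) →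
        mixedNorm q₁ (S.indicator fun x => ‖f x‖ₑ) < ∞ →
        mixedNorm q₂ (U.indicator (fracMaxComm l b f))
          ≤ C * mixedNorm q₁ (S.indicator fun x => ‖f x‖ₑ) + C * (twoPow (k * recipSum q₂) * H) := by
  have hq₁p : ∀ i, 0 < q₁ i := fun i => zero_lt_one.trans_le (hq₁ i)
  have hq₂p : ∀ i, 0 < q₂ i := fun i => zero_lt_one.trans_le (hq₂ i)
  obtain ⟨C₁, hC₁, hosc⟩ := exists_mixedNorm_osc_le hb hq₁p hq₂p hs hbdd
  obtain ⟨D, hD, hmean⟩ := exists_dyadicMean_sub_le hb hq₂ hC₁ hosc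
  obtain ⟨C₂, hC₂, hfar⟩ := exists_fracMaxComm_far_le hl hb hq₁ hq₂ hs hbdd hD hmean
  obtain ⟨C₀, hC₀⟩ := hbdd
  have hE := twoPow_ne_top (recipSum q₂)
  refine ⟨C₀ + C₂ * (C₁ + twoPow (recipSum q₂)), by finiteness,
    fun f hf k H hH hsum S U J hS hU hcover hdist hfin => ?_⟩
  set B := Metric.closedBall (0 : EuclideanSpace ℝ (Fin n)) ((2 : ℝ) ^ k) with hB
  have hBm : MeasurableSet B := Metric.isClosed_closedBall.measurableSet
  obtain ⟨⟨hTm, _⟩, hT⟩ := hC₀ _ (memMixedLp_indicator hf.1 hS hfin)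
  simp_rw [enorm_indicator_eq_indicator_enorm] at hT
  set g₁ := B.indicator fun x => ‖b x - dyadicMean b k‖ₑ with hg₁
  set g₂ := B.indicator (1 : EuclideanSpace ℝ (Fin n) → ℝ≥0∞) with hg₂
  have hg₁m : AEMeasurable g₁ :=
    (hb.aestronglyMeasurable.sub aestronglyMeasurable_const).enorm.indicator hBm
  have hg₂m : AEMeasurable g₂ := aemeasurable_const.indicator hBm
  -- The whole far part is one constant times g₁ + g₂, so Minkowski for finitely many functions
  -- suffices.
  have hpt : ∀ x, U.indicator (fracMaxComm l b f) x
      ≤ fracMaxComm l b (S.indicator f) x + C₂ * H * (g₁ x + g₂ x) := fun x => by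
    by_cases hx : x ∈ U
    · rw [indicator_of_mem hx]
      refine (fracMaxComm_le_add_tsum hb.aestronglyMeasurable hf.1 hS
        (fun j : J => measurableSet_annulus (j : ℤ)) hcover x).trans ?_
      gcongr
      calc ∑' j : J, fracMaxComm l b ((annulus n j).indicator f) x
          ≤ ∑' j : J, C₂ * (farWeight (n * (1 / Real.conjExponent l)) (n - recipSum q₁) k j *
              mixedNorm q₁ ((annulus n j).indicator fun x => ‖f x‖ₑ)) *
                (‖b x - dyadicMean b k‖ₑ + 1) :=
            ENNReal.tsum_le_tsum fun j => hfar f hf.1 k j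
              (hf.annulus_lt_top (fun i => (hq₁p i).le) _) x (hdist j j.2 x hx)
        _ ≤ ∑' j : ℤ, C₂ * (farWeight (n * (1 / Real.conjExponent l)) (n - recipSum q₁) k j *
              mixedNorm q₁ ((annulus n j).indicator fun x => ‖f x‖ₑ)) *
                (‖b x - dyadicMean b k‖ₑ + 1) :=
            ENNReal.tsum_comp_le_tsum_of_injective Subtype.val_injective _
        _ ≤ C₂ * H * (‖b x - dyadicMean b k‖ₑ + 1) := by
            rw [ENNReal.tsum_mul_right, ENNReal.tsum_mul_left]
            gcongr
        _ = _ := by rw [hg₁, hg₂, indicator_of_mem (hU hx), indicator_of_mem (hU hx), Pi.one_apply]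
    · rw [indicator_of_notMem hx]
      exact zero_le
  have hg : mixedNorm q₂ (fun x => g₁ x + g₂ x)
      ≤ (C₁ + twoPow (recipSum q₂)) * twoPow (k * recipSum q₂) := by
    refine (mixedNorm_add_le hq₂ hg₁m hg₂m).trans ?_
    refine (add_le_add (hosc k) (mixedNorm_dyadicBall_le hq₂p k)).trans_eq ?_
    rw [add_mul C₁, ← twoPow_add (recipSum q₂)]
    congr 2
    ring
  calc mixedNorm q₂ (U.indicator (fracMaxComm l b f))
      ≤ mixedNorm q₂ fun x => fracMaxComm l b (S.indicator f) x + C₂ * H * (g₁ x + g₂ x) :=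
        mixedNorm_mono (fun i => (hq₂p i).le) hpt
    _ ≤ mixedNorm q₂ (fracMaxComm l b (S.indicator f)) +
          mixedNorm q₂ (fun x => C₂ * H * (g₁ x + g₂ x)) :=
        mixedNorm_add_le hq₂ hTm.aemeasurable ((hg₁m.add hg₂m).const_mul _)
    _ ≤ C₀ * mixedNorm q₁ (S.indicator fun x => ‖f x‖ₑ) +
          C₂ * H * ((C₁ + twoPow (recipSum q₂)) * twoPow (k * recipSum q₂)) := by
        rw [mixedNorm_const_mul hq₂p _ (ENNReal.mul_ne_top hC₂ hH)]
        gcongr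
    _ = C₀ * mixedNorm q₁ (S.indicator fun x => ‖f x‖ₑ) +
          C₂ * (C₁ + twoPow (recipSum q₂)) * (twoPow (k * recipSum q₂) * H) := by ring
    _ ≤ _ := by
        gcongr
        · exact le_self_add
        · exact le_add_self

theorem mixedNorm_union_le (hq : ∀ i, 1 ≤ q i) {g : EuclideanSpace ℝ (Fin n) → ℝ≥0∞}
    (hg : AEMeasurable g) {S T : Set (EuclideanSpace ℝ (Fin n))} (hS : MeasurableSet S)
    (hT : MeasurableSet T) :
    mixedNorm q ((S ∪ T).indicator g) ≤ mixedNorm q (S.indicator g) + mixedNorm q (T.indicator g) := by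
  refine le_trans (mixedNorm_mono (fun i => zero_le_one.trans (hq i)) fun x => ?_)
    (mixedNorm_add_le hq (hg.indicator hS) (hg.indicator hT))
  by_cases h1 : x ∈ S <;> by_cases h2 : x ∈ T <;> simp [h1, h2]

/-- Only the origin is missed, a null set in positive dimension. -/
theorem ae_exists_mem_annulus (hn : 1 ≤ n) :
    ∀ᵐ y : EuclideanSpace ℝ (Fin n), ∃ j, y ∈ annulus n j := by
  have : Nonempty (Fin n) := ⟨⟨0, hn⟩⟩
  filter_upwards [compl_mem_ae_iff.2 (measure_singleton (0 : EuclideanSpace ℝ (Fin n)))] with y hy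
  exact exists_mem_annulus hy

theorem boundedHerzMorrey_fracMaxComm (hn : 1 ≤ n) (hl : 1 < l) (hb : LocallyIntegrable b volume)
    {lam α : ℝ} (hlam : 0 ≤ lam) {p₁ p₂ : ℝ≥0∞} (hp₁ : 0 < p₁) (hp : p₁ ≤ p₂)
    (hq₁ : ∀ i, 1 ≤ q₁ i) (hq₂ : ∀ i, 1 ≤ q₂ i)
    (hs : n * (1 / Real.conjExponent l) = n - recipSum q₁ + recipSum q₂)
    (hα₁ : lam - recipSum q₂ < α) (hα₂ : α < n - recipSum q₁)
    (hbdd : BoundedMixedLp q₁ q₂ (fracMaxComm l b)) :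
    BoundedHerzMorrey α lam p₁ p₂ q₁ q₂ (fracMaxComm l b) := by
  obtain ⟨e, he, h1, h2⟩ : ∃ e : ℝ, 0 < e ∧ 3 * e ≤ α + recipSum q₂ - lam ∧
      3 * e ≤ n - recipSum q₁ - α + lam := by
    -- A third of the smaller gap; the second gap is taken without λ, which is harmless since λ ≥ 0.
    refine ⟨min (α + recipSum q₂ - lam) (n - recipSum q₁ - α) / 3, ?_, ?_, ?_⟩
    · have : 0 < min (α + recipSum q₂ - lam) (n - recipSum q₁ - α) :=
        lt_min (by linarith) (by linarith)
      positivity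
    · linarith [min_le_left (α + recipSum q₂ - lam) (n - recipSum q₁ - α)]
    · linarith [min_le_right (α + recipSum q₂ - lam) (n - recipSum q₁ - α)]
  have hq₁0 : ∀ i, 0 ≤ q₁ i := fun i => zero_le_one.trans (hq₁ i)
  obtain ⟨C₁, hC₁, hmain⟩ := exists_mixedNorm_fracMaxComm_le hl hb hq₁ hq₂ hs hbdd
  obtain ⟨C₂, hC₂, htail⟩ := exists_tsum_farWeight_le hs he h1 h2
  have hE := twoPow_ne_top (e + lam + |α|)
  obtain ⟨C', hC', hseq⟩ := tailNorm_le_of_le_iSup hp₁ hlam he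
    -- Each of the three near annuli costs 2^{e+λ+|α|}, and C₂ accounts for the far sum.
    (C := C₁ * (3 * twoPow (e + lam + |α|) + C₂)) (by finiteness)
  refine ⟨C'.toNNReal, fun f ⟨hloc, hfin⟩ => ?_⟩
  rw [ENNReal.coe_toNNReal hC']
  set A := herzMorreyNorm α lam p₁ q₁ fun x => ‖f x‖ₑ with hA
  set N : ℤ → ℝ≥0∞ := fun k => mixedNorm q₁ ((annulus n k).indicator fun x => ‖f x‖ₑ) with hN
  set a : ℤ → ℝ≥0∞ := fun k => twoPow (k * α) * N k with ha
  set d : ℤ → ℝ≥0∞ := fun k =>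
    twoPow (k * α) * mixedNorm q₂ ((annulus n k).indicator (fracMaxComm l b f)) with hd
  have hNfin : ∀ k, N k < ∞ := hloc.annulus_lt_top hq₁0
  have haA : ∀ k₀ : ℤ, tailNorm p₁ a k₀ ≤ twoPow (k₀ * lam) * A := fun k₀ => by
    refine le_twoPow_mul_of_twoPow_neg_mul_le ?_
    rw [hA, herzMorreyNorm_eq]
    exact le_iSup (fun k₀ : ℤ => twoPow (-(k₀ * lam)) * tailNorm p₁ a k₀) k₀
  set M : ℤ → ℝ≥0∞ := fun k =>
    ⨆ m : ℤ, twoPow (-(e * |(m : ℝ)|) - m * lam) * a (k + m) with hM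
  -- Finiteness is needed to pull the far constant out of the mixed norm.
  have hMfin : ∀ k, M k ≠ ∞ := fun k => by
    have : M k ≤ twoPow (k * lam) * A := iSup_le fun m => by
      calc twoPow (-(e * |(m : ℝ)|) - m * lam) * a (k + m)
          ≤ twoPow (-(e * |(m : ℝ)|) - m * lam) * (twoPow ((k + m : ℤ) * lam) * A) := by
            gcongr
            exact (le_tailNorm hp₁ a le_rfl).trans (haA _)
        _ = twoPow (k * lam - e * |(m : ℝ)|) * A := by
            rw [← mul_assoc, ← twoPow_add]
            congr 2
            push_cast
            ring
        _ ≤ _ := by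
            gcongr
            refine twoPow_mono (sub_le_self _ (by positivity))
    exact ne_top_of_le_ne_top (ENNReal.mul_ne_top (twoPow_ne_top _) hfin.ne) this
  have hfarsum : ∀ k : ℤ, ∑' j, farWeight (n * (1 / Real.conjExponent l)) (n - recipSum q₁) k j *
      N j ≤ twoPow (-(k * α + k * recipSum q₂)) * (C₂ * M k) := fun k => by
    refine le_twoPow_mul_of_twoPow_neg_mul_le ?_
    rw [neg_neg]
    exact htail N k
  have hHfin : ∀ k : ℤ, twoPow (-(k * α + k * recipSum q₂)) * (C₂ * M k) ≠ ∞ := fun k =>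
    ENNReal.mul_ne_top (twoPow_ne_top _) (ENNReal.mul_ne_top hC₂ (hMfin k))
  have hnear : ∀ k m : ℤ, |(m : ℝ)| ≤ 1 →
      twoPow (k * α) * N (k + m) ≤ twoPow (e + lam + |α|) * M k := fun k m hm => by
    calc twoPow (k * α) * N (k + m)
        = twoPow (e * |(m : ℝ)| + m * lam + -(m * α)) *
            (twoPow (-(e * |(m : ℝ)|) - m * lam) * a (k + m)) := by
          rw [ha, ← mul_assoc, ← mul_assoc, ← twoPow_add, ← twoPow_add]
          congr 2
          push_cast
          ring
      _ ≤ twoPow (e + lam + |α|) * M k := by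
          gcongr
          · refine twoPow_mono ?_
            have h3 : e * |(m : ℝ)| ≤ e := mul_le_of_le_one_right he.le hm
            have h4 : m * lam ≤ lam := mul_le_of_le_one_left hlam ((le_abs_self _).trans hm)
            have h5 : -(m * α) ≤ |α| := (neg_le_abs _).trans <| by
              rw [abs_mul]
              exact mul_le_of_le_one_left (abs_nonneg _) hm
            linarith
          · exact le_iSup (fun m : ℤ => twoPow (-(e * |(m : ℝ)|) - m * lam) * a (k + m)) m
  have hdM : ∀ k, d k ≤ C₁ * (3 * twoPow (e + lam + |α|) + C₂) * M k := fun k => by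
    set S := (annulus n (k + -1) ∪ annulus n (k + 0)) ∪ annulus n (k + 1) with hS
    have hSm : MeasurableSet S :=
      ((measurableSet_annulus _).union (measurableSet_annulus _)).union (measurableSet_annulus _)
    have hSN : mixedNorm q₁ (S.indicator fun x => ‖f x‖ₑ) ≤ N (k + -1) + N (k + 0) + N (k + 1) :=
      (mixedNorm_union_le hq₁ hloc.1.enorm
        ((measurableSet_annulus _).union (measurableSet_annulus _)) (measurableSet_annulus _)).trans
        (by gcongr; exact mixedNorm_union_le hq₁ hloc.1.enorm (measurableSet_annulus _)
              (measurableSet_annulus _))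
    have hSfin : mixedNorm q₁ (S.indicator fun x => ‖f x‖ₑ) < ∞ :=
      hSN.trans_lt (ENNReal.add_lt_top.2 ⟨ENNReal.add_lt_top.2 ⟨hNfin _, hNfin _⟩, hNfin _⟩)
    -- The near set consists of the annuli k-1, k, k+1; all others are far from A_k.
    have h := hmain f hloc k _ (hHfin k) (hfarsum k) S (annulus n k) {j | j ≤ k - 2 ∨ k + 2 ≤ j} hSm
      (annulus_subset k) ?_ ?_ hSfin
    · calc d k ≤ twoPow (k * α) * (C₁ * (N (k + -1) + N (k + 0) + N (k + 1)) +
            C₁ * (twoPow (k * recipSum q₂) *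
              (twoPow (-(k * α + k * recipSum q₂)) * (C₂ * M k)))) := by
            rw [hd]
            refine mul_le_mul_right (h.trans ?_) _
            gcongr
        _ = C₁ * (twoPow (k * α) * N (k + -1) + twoPow (k * α) * N (k + 0) +
              twoPow (k * α) * N (k + 1)) + C₁ * (twoPow (-(k * α + k * recipSum q₂)) *
                twoPow (k * α + k * recipSum q₂)) * (C₂ * M k) := by
            rw [twoPow_add (k * α)]
            ring
        _ ≤ C₁ * (twoPow (e + lam + |α|) * M k + twoPow (e + lam + |α|) * M k +
              twoPow (e + lam + |α|) * M k) + C₁ * 1 * (C₂ * M k) := by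
            rw [twoPow_neg_mul_cancel]
            refine add_le_add_left (mul_le_mul_right (add_le_add (add_le_add ?_ ?_) ?_) _) _
            · exact hnear k (-1) (by simp)
            · exact hnear k 0 (by simp)
            · exact hnear k 1 (by simp)
        _ = _ := by ring
    · filter_upwards [ae_exists_mem_annulus hn] with y ⟨j, hj⟩
      rcases le_or_gt j (k - 2) with h3 | h3
      · exact Or.inr ⟨⟨j, Or.inl h3⟩, hj⟩
      rcases le_or_gt (k + 2) j with h4 | h4
      · exact Or.inr ⟨⟨j, Or.inr h4⟩, hj⟩
      have : j = k + -1 ∨ j = k + 0 ∨ j = k + 1 := by omega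
      rcases this with rfl | rfl | rfl
      · exact Or.inl (Or.inl (Or.inl hj))
      · exact Or.inl (Or.inl (Or.inr hj))
      · exact Or.inl (Or.inr hj)
    · rintro j (hj | hj) x hx y hy
      · exact lt_dist_of_inner hj hx hy
      · exact lt_dist_of_outer hj (annulus_subset k hx) hy
  have hTloc : MemMixedLpLoc q₂ (fracMaxComm l b f) := by
    refine ⟨aestronglyMeasurable_fracMaxComm hbdd hloc, fun K hK => ?_⟩
    obtain ⟨r, hr⟩ := hK.isBounded.subset_closedBall (0 : EuclideanSpace ℝ (Fin n))
    obtain ⟨k, hk⟩ := pow_unbounded_of_one_lt r (one_lt_two (α := ℝ))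
    have hKk : K ⊆ Metric.closedBall 0 ((2 : ℝ) ^ (k : ℤ)) :=
      hr.trans (Metric.closedBall_subset_closedBall (by rw [zpow_natCast]; exact hk.le))
    have hSfin := hloc.2 (Metric.closedBall 0 ((2 : ℝ) ^ ((k : ℤ) + 1))) (isCompact_closedBall _ _)
    -- K may reach the origin, so no inner annulus is far from it: the near set is the whole ball
    -- B_{k+1}, and only j ≥ k+2 is far.
    have h := hmain f hloc k _ (hHfin k) (hfarsum k)
      (Metric.closedBall 0 ((2 : ℝ) ^ ((k : ℤ) + 1))) K {j | (k : ℤ) + 2 ≤ j}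
      Metric.isClosed_closedBall.measurableSet hKk ?_ ?_ hSfin
    · simp only [enorm_eq_self]
      exact h.trans_lt (ENNReal.add_lt_top.2 ⟨ENNReal.mul_lt_top hC₁.lt_top hSfin,
        ENNReal.mul_lt_top hC₁.lt_top (ENNReal.mul_lt_top (twoPow_ne_top _).lt_top
          (hHfin k).lt_top)⟩)
    · filter_upwards [ae_exists_mem_annulus hn] with y ⟨j, hj⟩
      rcases le_or_gt ((k : ℤ) + 2) j with h4 | h4
      · exact Or.inr ⟨⟨j, h4⟩, hj⟩
      · exact Or.inl (Metric.closedBall_subset_closedBall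
          (zpow_le_zpow_right₀ one_le_two (by omega)) (annulus_subset j hj))
    · exact fun j hj x hx y hy => lt_dist_of_outer hj (hKk hx) hy
  have hnorm : herzMorreyNorm α lam p₂ q₂ (fracMaxComm l b f) ≤ C' * A := by
    rw [herzMorreyNorm_eq]
    refine iSup_le fun k₀ => ?_
    calc twoPow (-(k₀ * lam)) * tailNorm p₂ d k₀
        ≤ twoPow (-(k₀ * lam)) * (twoPow (k₀ * lam) * (C' * A)) := by
          gcongr
          -- The sequence estimate is applied with p₁ throughout; passing to p₂ happens only here,
          -- on the output.
          exact (tailNorm_anti hp₁ hp d k₀).trans (hseq a d A haA hdM k₀)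
      _ = C' * A := by rw [← mul_assoc, twoPow_neg_mul_cancel, one_mul]
  refine ⟨⟨hTloc, ?_⟩, hnorm⟩
  simp only [enorm_eq_self]
  exact hnorm.trans_lt (ENNReal.mul_lt_top hC'.lt_top hfin)

end Operator

end MixedHerzMorrey

theorem theorem4p2 {n : ℕ} (hn : 1 ≤ n) {𝕜 : Type*} [RCLike 𝕜]
    (b : EuclideanSpace ℝ (Fin n) → 𝕜) (hb : MixedHerzMorrey.MemBMO b)
    (l lam α : ℝ) (hl : 1 < l) (hlam : 0 ≤ lam)
    (p₁ p₂ : ℝ≥0∞) (hp₁ : 0 < p₁) (hp : p₁ ≤ p₂)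
    (q₁ q₂ : Fin n → ℝ) (hq₁ : ∀ i, 1 < q₁ i ∧ q₁ i < l) (hq₂ : ∀ i, 1 ≤ q₂ i)
    (hlq : 1 / l = 1 / (n : ℝ) * ∑ i, 1 / q₁ i - 1 / (n : ℝ) * ∑ i, 1 / q₂ i)
    (hα₁ : lam - ∑ i, 1 / q₂ i < α) (hα₂ : α < n - ∑ i, 1 / q₁ i)
    (hbdd : MixedHerzMorrey.BoundedMixedLp q₁ q₂ (MixedHerzMorrey.fracMaxComm l b)) :
    MixedHerzMorrey.BoundedHerzMorrey α lam p₁ p₂ q₁ q₂ (MixedHerzMorrey.fracMaxComm l b) := by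
  have hs : n * (1 / Real.conjExponent l)
      = n - MixedHerzMorrey.recipSum q₁ + MixedHerzMorrey.recipSum q₂ := by
    have hn0 : (n : ℝ) ≠ 0 := by positivity
    have hl0 : l ≠ 0 := by positivity
    -- Multiplying 1/l' = 1 - 1/l by n puts the exponent relation in the form n/l' = n - s₁ + s₂.
    have h1 : 1 / Real.conjExponent l = 1 - 1 / l := by
      rw [Real.conjExponent, one_div_div, sub_div, div_self hl0]
    rw [h1, hlq, MixedHerzMorrey.recipSum, MixedHerzMorrey.recipSum]
    field_simp
    ring
  exact MixedHerzMorrey.boundedHerzMorrey_fracMaxComm hn hl hb.1 hlam hp₁ hp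
    (fun i => (hq₁ i).1.le) hq₂ hs hα₁ hα₂ hbdd
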